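/- **Setting.** Let $\mathbb R_+=[0,\infty)$, $r\in\mathbb R$, $T>0$, $S_0>0$, let $S_T:\Omega\to\mathbb R_+$ and $\mathcal F=\sigma(S_T)$. Let $\mathbb Q$ be a probability measure on $(\Omega,\mathcal F)$ with $e^{-rT}E_{\mathbb Q}[S_T]=S_0$, and let $\mathcal P$ be a set of probability measures on $(\Omega,\mathcal F)$, each equivalent to $\mathbb Q$. The set of payoffs is $\mathcal X=\{g(S_T): g:\mathbb R_+\to\mathbb R_+\text{ measurable},\ E_{\mathbb Q}[g(S_T)]<\infty\}$; the price of $X\in\mathcal X$ is $e^{-rT}E_{\mathbb Q}[X]$. Write $F_X^{\mathbb P}$ for the distribution function of $X$ under $\mathbb P$, $F^{-1}(p)=\inf\{x\in\mathbb R_+:F(x)\ge p\}\in[0,\infty]$ (with $\inf\emptyset=\infty$) for the quantile function of a distribution on $\mathbb R_+$, and $\ell^{\mathbb P}=\frac{d\mathbb P}{d\mathbb Q}$. For a set $\mathbb F$ of functions $\mathbb R_+\to\mathbb R$, $F\preceq_{\mathbb F}G$ means $\int f\,dF\le\int f\,dG$ for all $f\in\mathbb F$ for which both integrals are finite. $\mathbb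 F_{FSD}$ is the set of non-decreasing functions $\mathbb R_+\to\mathbb R$, and $\mathbb F_{SSD}$ the set of those that are also concave. $\mathbb F$ is *composition-consistent* if $f\circ g\in\mathbb F$ whenever $f,g\in\mathbb F$ and $g\ge 0$. A payoff $X$ is *$\mathbb P$-cost-efficient* if it has the least price among all payoffs $Y$ with $F_Y^{\mathbb P}=F_X^{\mathbb P}$. $\mathbb F$ is *cost-consistent* if for all $\mathbb P\in\mathcal P$ and all $\mathbb P$-cost-efficient $X,Y\in\mathcal X$ with $F_X^{\mathbb P}\preceq_{\mathbb F}F_Y^{\mathbb P}$ one has $E_{\mathbb Q}[X]\le E_{\mathbb Q}[Y]$, with strict inequality if $F_X^{\mathbb P}\ne F_Y^{\mathbb P}$. A payoff $X$ solves the *$\mathbb F$-robust cost-efficiency problem for $F_0$* if it has the least price among all payoffs $Y$ with $F_0\preceq_{\mathbb F}F_Y^{\mathbb P}$ for all $\mathbb P\in\mathcal P$, and is one of them. A *family of preferences* $(W_{\mathbb P})_{\mathbb P\in\mathcal P}$ consists of functionals $W_{\mathbb P}:\mathcal X\to\mathbb R$; it is *law invariant* if $F_X^{\mathbb P}=F_Y^{\mathbb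 P}$ implies $W_{\mathbb P}(X)=W_{\mathbb P}(Y)$ for all $\mathbb P\in\mathcal P$, $X,Y\in\mathcal X$. It is *$\mathbb F$-family consistent on $\mathcal Y\subset\mathcal X$ with respect to $\mathbb P^*$* if for every $Y\in\mathcal Y$ with $F_Y^{\mathbb P^*}\preceq_{\mathbb F}F_Y^{\mathbb P}$ for all $\mathbb P\in\mathcal P$ one has $W_{\mathbb P^*}(Y)\le W_{\mathbb P}(Y)$ for all $\mathbb P\in\mathcal P$. For a functional $V$ on $\mathcal X$ (real-valued, or an expected utility, which may be infinite or undefined) let $\mathcal Y_V^{x_0}=\{X\in\mathcal X: V(X)\in\mathbb R,\ e^{-rT}E_{\mathbb Q}[X]\le x_0\}$, and $\mathcal Y^{x_0}_{(V_{\mathbb P})_{\mathbb P\in\mathcal P}}=\bigcap_{\mathbb P\in\mathcal P}\mathcal Y^{x_0}_{V_{\mathbb P}}$. Uniqueness of a solution means $\mathbb P^*$-a.s. uniqueness. **Theorem 5.** Let $\mathbb F_{SSD}\subset\mathbb F\subset\mathbb F_{FSD}$, and let $\mathbb F$ be composition-consistent and cost-consistent. Let $\mathbb P^*\in\mathcal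 P$, with $\ell^*=\ell^{\mathbb P^*}$, be a least favorable measure with respect to $\mathbb F$, i.e. $F_{\ell^*}^{\mathbb P^*}\preceq_{\mathbb F}F_{\ell^*}^{\mathbb P}$ for all $\mathbb P\in\mathcal P$. Assume that $F_{\ell^*}^{\mathbb P^*}$ is continuous and that $1/\ell^*$ has finite variance under $\mathbb P^*$. Let $X^*\in\mathcal X$, $x_0=e^{-rT}E_{\mathbb Q}[X^*]$, let $c>0$ with $F_{X^*}^{\mathbb P^*}(c)>0$, let $\xi^*=e^{-rT}/\ell^*$, and define $$u(x)=\int_c^x\big[F_{\xi^*}^{\mathbb P^*}\big]^{-1}\big(1-F_{X^*}^{\mathbb P^*}(y)\big)\,dy\in[-\infty,\infty),\qquad x\in\mathbb R_+.$$ Assume $E_{\mathbb P}[u(X^*)]<\infty$ for all $\mathbb P\in\mathcal P$, and one of the following: (a) $\mathbb F=\mathbb F_{FSD}$; (b) $X^*=f(\ell^*)$ $\mathbb P^*$-a.s. for some $f\in\mathbb F$, and $[F_{X^*}^{\mathbb P^*}]^{-1}\circ F_{\ell^*}^{\mathbb P^*}\in\mathbb F$, in the sense that some $g\in\mathbb F$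 with $g\ge0$ coincides with this composition at all $x$ with $0<F_{\ell^*}^{\mathbb P^*}(x)<1$. Then the following are equivalent: i) $X^*$ is $\mathbb P^*$-cost-efficient. ii) $X^*=[F_{X^*}^{\mathbb P^*}]^{-1}\big(F_{\ell^*}^{\mathbb P^*}(\ell^*)\big)$, $\mathbb P^*$-a.s. iii) $X^*$ is $\mathbb P^*$-a.s. non-decreasing in $\ell^*$: there is a set $A$ of full $\mathbb P^*$-measure such that $\ell^*(\omega)\le\ell^*(\omega')$ implies $X^*(\omega)\le X^*(\omega')$ for $\omega,\omega'\in A$. iv) $X^*$ solves the $\mathbb F$-robust cost-efficiency problem for $F_{X^*}^{\mathbb P^*}$. v) $X^*$ solves $\max_{X\in\mathcal Y^{x_0}_{E_{\mathbb P^*}[u(\cdot)]}}E_{\mathbb P^*}[u(X)]$. vi) $X^*$ solves $\max_{X\in\mathcal Y^{x_0}_{(E_{\mathbb P}[u(\cdot)])_{\mathbb P\in\mathcal P}}}\inf_{\mathbb P\in\mathcal P}E_{\mathbb P}[u(X)]$, and the solution is unique if (a) holds. vii) There is a family of preferences $(W_{\mathbb P})_{\mathbb P\in\mathcal P}$ that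 is $\mathbb F$-family consistent on $\mathcal Y^{x_0}_{(W_{\mathbb P})_{\mathbb P\in\mathcal P}}$ with respect to $\mathbb P^*$ such that $X^*\in\mathcal Y^{x_0}_{(W_{\mathbb P})_{\mathbb P\in\mathcal P}}$ and $X^*$ solves $\max_{X\in\mathcal Y^{x_0}_{W_{\mathbb P^*}}}W_{\mathbb P^*}(X)$; and, if (a) holds, the solution is unique and the family is law invariant. viii) There is a family of preferences $(W_{\mathbb P})_{\mathbb P\in\mathcal P}$ that is $\mathbb F$-family consistent on $\mathcal Y^{x_0}_{(W_{\mathbb P})_{\mathbb P\in\mathcal P}}$ with respect to $\mathbb P^*$ such that $X^*$ solves $\max_{X\in\mathcal Y^{x_0}_{(W_{\mathbb P})_{\mathbb P\in\mathcal P}}}\inf_{\mathbb P\in\mathcal P}W_{\mathbb P}(X)$; and, if (a) holds, the solution is unique and the family is law invariant. -/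

import Mathlib

open MeasureTheory
open scoped NNReal ENNReal

noncomputable section

namespace RobustCE

/-! ### Distributions on `[0, ∞)`

A distribution with support in `[0, ∞)` is represented by the corresponding Borel measure
on `ℝ≥0`; its distribution function is `distFun`. -/

/-- The distribution (law) of the nonnegative random variable `X` under `P`. -/
def law {Ω : Type*} [MeasurableSpace Ω] (P : Measure Ω) (X : Ω → ℝ≥0) : Measure ℝ≥0 :=
  P.map X

/-- The cumulative distribution function of a distribution on `[0, ∞)`, as a function on `ℝ`. -/
def distFun (μ : Measure ℝ≥0) (x : ℝ) : ℝ :=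
  ProbabilityTheory.cdf (μ.map (fun y : ℝ≥0 => (y : ℝ))) x

/-- The quantile function `p ↦ inf {x ∈ [0, ∞) : F(x) ≥ p}`, with `inf ∅ = ∞`. -/
def quantile (μ : Measure ℝ≥0) (p : ℝ) : ℝ≥0∞ :=
  ⨅ (x : ℝ≥0) (_ : p ≤ distFun μ x), (x : ℝ≥0∞)

/-- `μ ≼_𝔽 ν`: integral stochastic ordering with respect to `𝔽`; only those `f ∈ 𝔽` are tested
for which both expectations are finite. -/
def IntegralOrder (𝔽 : Set (ℝ≥0 → ℝ)) (μ ν : Measure ℝ≥0) : Prop :=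
  ∀ f ∈ 𝔽, Integrable f μ → Integrable f ν → ∫ x, f x ∂μ ≤ ∫ x, f x ∂ν

/-- All non-decreasing functions `[0, ∞) → ℝ`. -/
def FSD : Set (ℝ≥0 → ℝ) := {f | Monotone f}

/-- All non-decreasing concave functions `[0, ∞) → ℝ`. -/
def SSD : Set (ℝ≥0 → ℝ) := {f | Monotone f ∧ ConcaveOn ℝ≥0 Set.univ f}

/-- `f ∘ g ∈ 𝔽` for all `f, g ∈ 𝔽` for which the composition makes sense, that is, for which
`g` takes values in `[0, ∞)`. -/
def CompositionConsistent (𝔽 : Set (ℝ≥0 → ℝ)) : Prop :=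
  ∀ f ∈ 𝔽, ∀ g : ℝ≥0 → ℝ≥0, (fun x => (g x : ℝ)) ∈ 𝔽 → (fun x => f (g x)) ∈ 𝔽

/-! ### The market -/

/-- A static market with a bank account and one risky asset, under model ambiguity. -/
structure Market (Ω : Type*) [mΩ : MeasurableSpace Ω] where
  /-- interest rate -/
  r : ℝ
  /-- planning horizon -/
  T : ℝ
  T_pos : 0 < T
  /-- current value of the risky asset -/
  S₀ : ℝ
  S₀_pos : 0 < S₀
  /-- value of the risky asset at maturity -/
  S : Ω → ℝ≥0
  /-- the `σ`-algebra of `Ω` is the one generated by `S` -/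
  sigma_eq : mΩ = MeasurableSpace.comap S inferInstance
  /-- pricing measure -/
  Q : Measure Ω
  isProb_Q : IsProbabilityMeasure Q
  integrable_S : Integrable (fun ω => (S ω : ℝ)) Q
  martingale : Real.exp (-(r * T)) * ∫ ω, (S ω : ℝ) ∂Q = S₀
  /-- the set `𝒫` of plausible real-world measures -/
  models : Set (Measure Ω)
  isProb : ∀ P ∈ models, IsProbabilityMeasure P
  /-- all of them are equivalent to `Q` (hence to each other) -/
  equiv : ∀ P ∈ models, P ≪ Q ∧ Q ≪ P

namespace Market

variable {Ω : Type*} [MeasurableSpace Ω] (M : Market Ω)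

/-- The set `𝒳` of payoffs. -/
def payoffs : Set (Ω → ℝ≥0) :=
  {X | (∃ g : ℝ≥0 → ℝ≥0, Measurable g ∧ X = fun ω => g (M.S ω)) ∧
    Integrable (fun ω => (X ω : ℝ)) M.Q}

/-- The price `e^{-rT} E_Q[X]`. -/
def price (X : Ω → ℝ≥0) : ℝ :=
  Real.exp (-(M.r * M.T)) * ∫ ω, (X ω : ℝ) ∂M.Q

/-- The likelihood ratio `ℓ^P = dP/dQ`. -/
def lik (P : Measure Ω) (ω : Ω) : ℝ≥0 := (P.rnDeriv M.Q ω).toNNReal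

/-- The state price `ξ^P = e^{-rT} / ℓ^P`. -/
def statePrice (P : Measure Ω) (ω : Ω) : ℝ≥0 :=
  Real.toNNReal (Real.exp (-(M.r * M.T))) / M.lik P ω

/-! ### Cost-efficiency -/

/-- Admissible payoffs of the standard cost-efficiency problem for the distribution `F₀`. -/
def standardAdmissible (P : Measure Ω) (F₀ : Measure ℝ≥0) : Set (Ω → ℝ≥0) :=
  {X | X ∈ M.payoffs ∧ law P X = F₀}

/-- Admissible payoffs of the `𝔽`-robust cost-efficiency problem for the distribution `F₀`. -/
def robustAdmissible (𝔽 : Set (ℝ≥0 → ℝ)) (F₀ : Measure ℝ≥0) : Set (Ω → ℝ≥0) :=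
  {X | X ∈ M.payoffs ∧ ∀ P ∈ M.models, IntegralOrder 𝔽 F₀ (law P X)}

/-- `X` is a cheapest element of `A`. -/
def IsCheapest (A : Set (Ω → ℝ≥0)) (X : Ω → ℝ≥0) : Prop :=
  X ∈ A ∧ ∀ Y ∈ A, M.price X ≤ M.price Y

/-- `X` is `P`-cost-efficient. -/
def CostEfficient (P : Measure Ω) (X : Ω → ℝ≥0) : Prop :=
  M.IsCheapest (M.standardAdmissible P (law P X)) X

/-- `X` solves the `𝔽`-robust cost-efficiency problem for `F₀`. -/
def RobustCostEfficient (𝔽 : Set (ℝ≥0 → ℝ)) (F₀ : Measure ℝ≥0) (X : Ω → ℝ≥0) : Prop :=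
  M.IsCheapest (M.robustAdmissible 𝔽 F₀) X

/-- Cost-consistency of `𝔽`. -/
def CostConsistent (𝔽 : Set (ℝ≥0 → ℝ)) : Prop :=
  ∀ X ∈ M.payoffs, ∀ Y ∈ M.payoffs, ∀ P ∈ M.models,
    M.CostEfficient P X → M.CostEfficient P Y → IntegralOrder 𝔽 (law P X) (law P Y) →
      ∫ ω, (X ω : ℝ) ∂M.Q ≤ ∫ ω, (Y ω : ℝ) ∂M.Q ∧
      (law P X ≠ law P Y → ∫ ω, (X ω : ℝ) ∂M.Q < ∫ ω, (Y ω : ℝ) ∂M.Q)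

/-- `Pst` is a least favorable measure with respect to `𝔽`. -/
def LeastFavorable (𝔽 : Set (ℝ≥0 → ℝ)) (Pst : Measure Ω) : Prop :=
  Pst ∈ M.models ∧ ∀ P ∈ M.models, IntegralOrder 𝔽 (law Pst (M.lik Pst)) (law P (M.lik Pst))

/-- The likelihood ratio of `P` has a continuous distribution function under `P`, and its
reciprocal has finite variance under `P`. -/
def RegularLikelihood (P : Measure Ω) : Prop :=
  Continuous (distFun (law P (M.lik P))) ∧ MemLp (fun ω => 1 / (M.lik P ω : ℝ)) 2 P

/-- `X` is `P`-almost surely non-decreasing in `ℓ^P`. -/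
def NondecreasingInLik (P : Measure Ω) (X : Ω → ℝ≥0) : Prop :=
  ∃ A : Set Ω, (∀ᵐ ω ∂P, ω ∈ A) ∧
    ∀ ω ∈ A, ∀ ω' ∈ A, M.lik P ω ≤ M.lik P ω' → X ω ≤ X ω'

/-! ### Preferences and portfolio choice

Functionals on payoffs are allowed to be extended-real-valued here, because an expected utility
may fail to be finite. -/

/-- `𝒴^{x₀}_V`: payoffs with real `V`-value whose price is at most `x₀`. -/
def budget (V : (Ω → ℝ≥0) → EReal) (x₀ : ℝ) : Set (Ω → ℝ≥0) :=
  {X | X ∈ M.payoffs ∧ V X ≠ ⊥ ∧ V X ≠ ⊤ ∧ M.price X ≤ x₀}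

/-- `𝒴^{x₀}_{(V_P)}`: the intersection of the budget sets of all `V_P`, `P ∈ 𝒫`. -/
def robustBudget (V : Measure Ω → (Ω → ℝ≥0) → EReal) (x₀ : ℝ) : Set (Ω → ℝ≥0) :=
  {X | ∀ P ∈ M.models, X ∈ M.budget (V P) x₀}

/-- The worst-case value `inf_{P ∈ 𝒫} V_P(X)`. -/
def worstCase (V : Measure Ω → (Ω → ℝ≥0) → EReal) (X : Ω → ℝ≥0) : EReal :=
  ⨅ P ∈ M.models, V P X

/-- The family is law invariant. -/
def LawInvariant (V : Measure Ω → (Ω → ℝ≥0) → EReal) : Prop :=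
  ∀ P ∈ M.models, ∀ X ∈ M.payoffs, ∀ Y ∈ M.payoffs, law P X = law P Y → V P X = V P Y

/-- The family is `𝔽`-family consistent on `𝒴` with respect to `Pst`. -/
def FamilyConsistent (𝔽 : Set (ℝ≥0 → ℝ)) (𝒴 : Set (Ω → ℝ≥0)) (Pst : Measure Ω)
    (V : Measure Ω → (Ω → ℝ≥0) → EReal) : Prop :=
  ∀ Y ∈ 𝒴, (∀ P ∈ M.models, IntegralOrder 𝔽 (law Pst Y) (law P Y)) →
    ∀ P ∈ M.models, V Pst Y ≤ V P Y

/-- The function `u(x) = ∫_c^x F_ξ⁻¹(1 - F_X(y)) dy`, `x ∈ [0, ∞)`, where `ξ` is the state price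
of `P`, and the distributions are under `P`. The integrand is nonnegative and may be infinite,
so that `u` may take the value `-∞` to the left of `c`. -/
def utility (P : Measure Ω) (X : Ω → ℝ≥0) (c x : ℝ≥0) : EReal :=
  if c ≤ x then
    ((∫⁻ y in Set.Icc (c : ℝ) x,
      quantile (law P (M.statePrice P)) (1 - distFun (law P X) y) : ℝ≥0∞) : EReal)
  else
    -((∫⁻ y in Set.Icc (x : ℝ) c,
      quantile (law P (M.statePrice P)) (1 - distFun (law P X) y) : ℝ≥0∞) : EReal)

end Market

/-- The expected utility `E_P[u(X)] = E_P[u(X)⁺] - E_P[u(X)⁻]`; it is a real number exactly if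
both terms are finite (`∞ - ∞ = -∞` in `EReal`). -/
def expectedUtility {Ω : Type*} [MeasurableSpace Ω] (u : ℝ≥0 → EReal) (P : Measure Ω)
    (X : Ω → ℝ≥0) : EReal :=
  ((∫⁻ ω, (u (X ω)).toENNReal ∂P : ℝ≥0∞) : EReal) -
    ((∫⁻ ω, (-u (X ω)).toENNReal ∂P : ℝ≥0∞) : EReal)

/-- `X` solves the problem of maximizing `V` over `𝒴`. -/
def IsSolution {Ω : Type*} (𝒴 : Set (Ω → ℝ≥0)) (V : (Ω → ℝ≥0) → EReal) (X : Ω → ℝ≥0) : Prop :=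
  X ∈ 𝒴 ∧ ∀ Y ∈ 𝒴, V Y ≤ V X

/-- Every solution of the problem of maximizing `V` over `𝒴` is `P`-a.s. equal to `X`. -/
def OnlySolution {Ω : Type*} [MeasurableSpace Ω] (P : Measure Ω) (𝒴 : Set (Ω → ℝ≥0))
    (V : (Ω → ℝ≥0) → EReal) (X : Ω → ℝ≥0) : Prop :=
  ∀ Y, IsSolution 𝒴 V Y → Y =ᵐ[P] X

/-- A family of real-valued functionals on payoffs, viewed as extended-real-valued. -/
def ofReal {Ω : Type*} [MeasurableSpace Ω] (W : Measure Ω → (Ω → ℝ≥0) → ℝ) :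
    Measure Ω → (Ω → ℝ≥0) → EReal :=
  fun P X => (W P X : EReal)

/-- `X = f(ℓ^P)` `P`-a.s. for some `f ∈ 𝔽`, and `F_X⁻¹ ∘ F_ℓ ∈ 𝔽`. The values of `F_X⁻¹` at the
levels `0` and `1` depend on conventions; therefore the composition is only prescribed where
`F_ℓ` lies in `(0, 1)`, and some extension to a function `[0, ∞) → [0, ∞)` has to be in `𝔽`. -/
def Market.Compatible {Ω : Type*} [MeasurableSpace Ω] (M : Market Ω) (𝔽 : Set (ℝ≥0 → ℝ))
    (P : Measure Ω) (X : Ω → ℝ≥0) : Prop :=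
  (∃ f ∈ 𝔽, ∀ᵐ ω ∂P, (X ω : ℝ) = f (M.lik P ω)) ∧
  ∃ g : ℝ≥0 → ℝ≥0, (fun x => (g x : ℝ)) ∈ 𝔽 ∧
    ∀ x : ℝ≥0, 0 < distFun (law P (M.lik P)) x → distFun (law P (M.lik P)) x < 1 →
      (g x : ℝ≥0∞) = quantile (law P X) (distFun (law P (M.lik P)) x)

end RobustCE

end

namespace RobustCE

/-! ### Distribution functions and quantiles -/

section Distributions

variable {Ω : Type*} [MeasurableSpace Ω]

/-! Everything is compared with one payoff, `efficient`: the quantile function of $X^*$ evaluated at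
$F_{\ell^*}(\ell^*)$. Since $F_{\ell^*}$ is continuous, $F_{\ell^*}(\ell^*)$ is uniform under $P^*$,
so this payoff has the law of $X^*$ and is nondecreasing in $\ell^*$. Each of the eight statements
amounts to $X^*$ being a.s. equal to it.

Cost: by the Neyman-Pearson argument, upper level sets of $\ell^*$ are the $Q$-cheapest events of a
given $P^*$-probability. Integrating over the events $\{Y>t\}$ (`lintegral_le_of_nondecreasing`)
makes the efficient payoff the unique cheapest one with its law. Being monotone in $\ell^*$, it
inherits the stochastic order that makes $P^*$ least favorable (`integralOrder_efficient`), so it is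
admissible in the robust problem; cost-consistency then rules out anything cheaper.

Utility: the slope of $u$ is chosen so that $\xi^*$ is a supergradient of $u$ at the efficient
payoff (`statePrice_supergradient`). Integrating $u(Y)\le u(X^*)+\xi^*(Y-X^*)$ and using the budget
gives optimality. Equality would make the slope equal to $\xi^*$ on an interval wherever $Y\ne X^*$,
which an atomless $\xi^*$ a.s. avoids. Truncations of $u$ are concave test functions, so $P^*$ is
the worst case (`expectedUtility_le_of_integralOrder`) and the max-min problem reduces to the one
under $P^*$.

Converses: under (b), $X^*$ is monotone in $\ell^*$ outright. Under (a), an inefficient $X^*$ costs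
strictly more than its rearrangement; spending part of the saving on a constant strictly raises
expected utility (`exists_improvement`). For abstract preferences, law invariance makes the
efficient payoff another solution and uniqueness identifies it with $X^*$; such preferences exist
because expected utility can be squashed into the reals. -/

theorem distFun_mono (μ : Measure ℝ≥0) : Monotone (distFun μ) :=
  ProbabilityTheory.monotone_cdf _

theorem distFun_nonneg (μ : Measure ℝ≥0) (x : ℝ) : 0 ≤ distFun μ x :=
  ProbabilityTheory.cdf_nonneg _ _

theorem distFun_le_one (μ : Measure ℝ≥0) (x : ℝ) : distFun μ x ≤ 1 :=
  ProbabilityTheory.cdf_le_one _ _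

theorem distFun_law (P : Measure Ω) [IsProbabilityMeasure P] {X : Ω → ℝ≥0} (hX : Measurable X)
    (x : ℝ) : distFun (law P X) x = P.real {ω | (X ω : ℝ) ≤ x} := by
  have hm : Measurable (fun ω => (X ω : ℝ)) := by fun_prop
  have h1 : (law P X).map (fun y : ℝ≥0 => (y : ℝ)) = P.map (fun ω => (X ω : ℝ)) := by
    rw [law, Measure.map_map (by fun_prop) hX]; rfl
  have : IsProbabilityMeasure (P.map (fun ω => (X ω : ℝ))) :=
    Measure.isProbabilityMeasure_map hm.aemeasurable
  rw [distFun, h1, ProbabilityTheory.cdf_eq_real, map_measureReal_apply hm measurableSet_Iic]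
  rfl

theorem measureReal_lt_eq_one_sub_distFun (P : Measure Ω) [IsProbabilityMeasure P] {X : Ω → ℝ≥0}
    (hX : Measurable X) (x : ℝ) :
    P.real {ω | x < (X ω : ℝ)} = 1 - distFun (law P X) x := by
  rw [distFun_law P hX, ← probReal_compl_eq_one_sub (measurableSet_le (by fun_prop) (by fun_prop))]
  congr 1; ext ω; simp

/-- Right-continuity of the distribution function makes the infimum attained whenever it is finite,
which yields a Galois connection. -/
theorem quantile_le_iff (μ : Measure ℝ≥0) (p : ℝ) (x : ℝ≥0) :
    quantile μ p ≤ x ↔ p ≤ distFun μ x := by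
  constructor
  · intro h
    have key : ∀ r : Set.Ioi (x : ℝ), p ≤ distFun μ r := by
      rintro ⟨r, hr⟩
      have hr' : (x : ℝ) < r := hr
      have h0 : 0 ≤ r := x.2.trans hr'.le
      have hlt : quantile μ p < (r.toNNReal : ℝ≥0∞) := by
        refine h.trans_lt ?_
        rw [ENNReal.coe_lt_coe, ← NNReal.coe_lt_coe, Real.coe_toNNReal _ h0]
        exact hr'
      simp only [quantile, iInf_lt_iff] at hlt
      obtain ⟨y, hy, hyr⟩ := hlt
      refine hy.trans (distFun_mono μ ?_)
      rw [ENNReal.coe_lt_coe, ← NNReal.coe_lt_coe, Real.coe_toNNReal _ h0] at hyr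
      exact hyr.le
    rw [distFun, ← StieltjesFunction.iInf_Ioi_eq]
    exact le_ciInf key
  · intro h
    exact iInf₂_le x h

theorem quantile_mono (μ : Measure ℝ≥0) : Monotone (quantile μ) := fun _ _ hpq =>
  le_iInf₂ fun x hx => iInf₂_le x (hpq.trans hx)

theorem quantile_lt_top (μ : Measure ℝ≥0) {p : ℝ} (hp : p < 1) : quantile μ p < ⊤ := by
  have h := ProbabilityTheory.tendsto_cdf_atTop (μ.map (fun y : ℝ≥0 => (y : ℝ)))
  obtain ⟨x, hx⟩ := (h.eventually (lt_mem_nhds hp)).exists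
  have : quantile μ p ≤ (x.toNNReal : ℝ≥0) :=
    (quantile_le_iff _ _ _).2 (hx.le.trans (distFun_mono μ (Real.le_coe_toNNReal x)))
  exact this.trans_lt ENNReal.coe_lt_top

theorem exists_gt_distFun_lt (μ : Measure ℝ≥0) {x p : ℝ} (h : distFun μ x < p) :
    ∃ y, x < y ∧ distFun μ y < p := by
  by_contra! hc
  have : p ≤ distFun μ x := by
    rw [distFun, ← StieltjesFunction.iInf_Ioi_eq]
    exact le_ciInf fun r => hc r r.2
  exact absurd h this.not_gt

theorem law_eq_of_measure_lt {P : Measure Ω} [IsProbabilityMeasure P] {X Y : Ω → ℝ≥0}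
    (hX : Measurable X) (hY : Measurable Y)
    (h : ∀ t : ℝ≥0, P.real {ω | (t : ℝ) < X ω} = P.real {ω | (t : ℝ) < Y ω}) :
    law P X = law P Y := by
  have : IsProbabilityMeasure (law P X) := Measure.isProbabilityMeasure_map hX.aemeasurable
  have : IsProbabilityMeasure (law P Y) := Measure.isProbabilityMeasure_map hY.aemeasurable
  refine Measure.ext_of_Iic _ _ fun t => ?_
  rw [law, law, Measure.map_apply hX measurableSet_Iic, Measure.map_apply hY measurableSet_Iic]
  have hh := h t
  rw [measureReal_lt_eq_one_sub_distFun P hX, measureReal_lt_eq_one_sub_distFun P hY,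
    distFun_law P hX, distFun_law P hY] at hh
  have h2 := (measureReal_eq_measureReal_iff (μ := P) (ν := P) (by finiteness) (by finiteness)).1
    (show P.real {ω | (X ω : ℝ) ≤ t} = P.real {ω | (Y ω : ℝ) ≤ t} by linarith)
  exact h2

theorem measure_lt_eq_of_law_eq {P : Measure Ω} {X Y : Ω → ℝ≥0}
    (hX : Measurable X) (hY : Measurable Y) (h : law P X = law P Y) (t : ℝ) :
    P {ω | t < (X ω : ℝ)} = P {ω | t < (Y ω : ℝ)} := by
  have hs : MeasurableSet {x : ℝ≥0 | t < (x : ℝ)} :=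
    measurableSet_lt (by fun_prop) (by fun_prop)
  have h1 := congrArg (fun μ : Measure ℝ≥0 => μ {x : ℝ≥0 | t < (x : ℝ)}) h
  simpa [law, Measure.map_apply hX hs, Measure.map_apply hY hs] using h1

/-- The probability integral transform: `F_L(L)` is uniformly distributed if `F_L` is
continuous. -/
theorem measureReal_distFun_le (P : Measure Ω) [IsProbabilityMeasure P] {L : Ω → ℝ≥0}
    (hL : Measurable L) (hc : Continuous (distFun (law P L))) {p : ℝ} (hp0 : 0 ≤ p)
    (hp1 : p ≤ 1) : P.real {ω | distFun (law P L) (L ω) ≤ p} = p := by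
  set F := distFun (law P L) with hF
  have hmono : Monotone F := distFun_mono _
  -- The levels 0 and 1 need not be attained, so both bounds below approximate `p` by levels
  -- strictly inside the unit interval.
  have hlt : ∀ q, 0 < q → q < 1 → ∃ a, F a = q := by
    intro q h0 h1
    have hb := ProbabilityTheory.tendsto_cdf_atBot ((law P L).map (fun y : ℝ≥0 => (y : ℝ)))
    have ht := ProbabilityTheory.tendsto_cdf_atTop ((law P L).map (fun y : ℝ≥0 => (y : ℝ)))
    obtain ⟨a, ha⟩ := (hb.eventually (gt_mem_nhds h0)).exists
    obtain ⟨b, hb⟩ := (ht.eventually (lt_mem_nhds h1)).exists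
    exact mem_range_of_exists_le_of_exists_ge hc ⟨a, ha.le⟩ ⟨b, hb.le⟩
  apply le_antisymm
  · refine le_of_forall_gt fun q hq => ?_
    by_cases hq1 : 1 < q
    · exact measureReal_le_one.trans_lt hq1
    obtain ⟨r, hpr, hrq⟩ := exists_between hq
    obtain ⟨a, ha⟩ := hlt r (by linarith) (by linarith)
    have : P.real {ω | F (L ω) ≤ p} ≤ P.real {ω | (L ω : ℝ) ≤ a} := by
      refine measureReal_mono fun ω hω => ?_
      by_contra hcon
      have := hmono (le_of_lt (not_le.1 hcon))
      simp only [Set.mem_ofPred_eq] at hω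
      linarith
    rw [← distFun_law P hL, ← hF, ha] at this
    linarith
  · refine le_of_forall_lt fun q hq => ?_
    obtain ⟨r, hqr, hrp⟩ := exists_between hq
    by_cases hr : r ≤ 0
    · exact (hqr.trans_le hr).trans_le measureReal_nonneg
    obtain ⟨a, ha⟩ := hlt r (by linarith) (by linarith)
    have : P.real {ω | (L ω : ℝ) ≤ a} ≤ P.real {ω | F (L ω) ≤ p} := by
      refine measureReal_mono fun ω hω => ?_
      have := hmono (show (L ω : ℝ) ≤ a from hω)
      simp only [Set.mem_ofPred_eq]
      linarith
    rw [← distFun_law P hL, ← hF, ha] at this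
    linarith

/-- Uniformity excludes the levels 0 and 1, where quantiles depend on conventions or may be
infinite. -/
theorem ae_distFun_mem_Ioo (P : Measure Ω) [IsProbabilityMeasure P] {L : Ω → ℝ≥0}
    (hL : Measurable L) (hc : Continuous (distFun (law P L))) :
    ∀ᵐ ω ∂P, 0 < distFun (law P L) (L ω) ∧ distFun (law P L) (L ω) < 1 := by
  have hm : Measurable fun ω => distFun (law P L) (L ω) :=
    hc.measurable.comp (by fun_prop)
  have h0 := measureReal_distFun_le P hL hc le_rfl zero_le_one
  have h1 : P.real {ω | 1 ≤ distFun (law P L) (L ω)} = 0 := by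
    have hle : ∀ q : ℝ, 0 ≤ q → q < 1 → P.real {ω | 1 ≤ distFun (law P L) (L ω)} ≤ 1 - q := by
      intro q hq0 hq1
      rw [← measureReal_distFun_le P hL hc hq0 hq1.le,
        ← probReal_compl_eq_one_sub (measurableSet_le hm measurable_const)]
      refine measureReal_mono fun ω hω => ?_
      simp only [Set.mem_ofPred_eq, Set.mem_compl_iff, not_le] at hω ⊢
      linarith
    refine le_antisymm (le_of_forall_pos_le_add fun ε hε => ?_) measureReal_nonneg
    have := hle (max 0 (1 - ε)) (le_max_left _ _) (by simp [hε])
    have := le_max_right 0 (1 - ε)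
    linarith
  have a0 : ∀ᵐ ω ∂P, ¬ distFun (law P L) (L ω) ≤ 0 := by
    rw [ae_iff]; simpa [measureReal_eq_zero_iff] using h0
  have a1 : ∀ᵐ ω ∂P, ¬ 1 ≤ distFun (law P L) (L ω) := by
    rw [ae_iff]; simpa [measureReal_eq_zero_iff] using h1
  filter_upwards [a0, a1] with ω h h'
  exact ⟨not_le.1 h, not_le.1 h'⟩

theorem measure_eq_const_eq_zero (P : Measure Ω) [IsProbabilityMeasure P] {L : Ω → ℝ≥0}
    (hL : Measurable L) (hc : Continuous (distFun (law P L))) (a : ℝ≥0) :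
    P {ω | L ω = a} = 0 := by
  rw [← measureReal_eq_zero_iff]
  refine le_antisymm (le_of_forall_pos_le_add fun ε hε => ?_) measureReal_nonneg
  obtain ⟨δ, hδ, h⟩ := Metric.continuous_iff.1 hc a ε hε
  have h1 := h (a - δ / 2) (by rw [Real.dist_eq, abs_lt]; constructor <;> linarith)
  rw [Real.dist_eq, abs_lt] at h1
  have hdisj : Disjoint {ω | L ω = a} {ω | (L ω : ℝ) ≤ a - δ / 2} := by
    rw [Set.disjoint_left]
    intro ω h1 h2
    simp only [Set.mem_ofPred_eq] at h1 h2
    rw [h1] at h2; linarith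
  have h2 : P.real ({ω | L ω = a} ∪ {ω | (L ω : ℝ) ≤ a - δ / 2}) ≤ P.real {ω | (L ω : ℝ) ≤ a} := by
    refine measureReal_mono fun ω hω => ?_
    rcases hω with hω | hω
    · simp only [Set.mem_ofPred_eq] at hω ⊢; rw [hω]
    · simp only [Set.mem_ofPred_eq] at hω ⊢; linarith
  rw [measureReal_union hdisj (measurableSet_le (by fun_prop) (by fun_prop)),
    ← distFun_law P hL, ← distFun_law P hL] at h2
  linarith

/-- `F_X⁻¹(F_L(L))`, the payoff with the distribution of `X` that is increasing in `L`. -/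
noncomputable def rearrangement (P : Measure Ω) (L X : Ω → ℝ≥0) (ω : Ω) : ℝ≥0 :=
  (quantile (law P X) (distFun (law P L) (L ω))).toNNReal

theorem measurable_rearrangement (P : Measure Ω) {L : Ω → ℝ≥0} (hL : Measurable L)
    (X : Ω → ℝ≥0) : Measurable (rearrangement P L X) := by
  refine ENNReal.measurable_toNNReal.comp ((quantile_mono _).measurable.comp ?_)
  exact (distFun_mono _).measurable.comp (by fun_prop)

theorem coe_rearrangement (P : Measure Ω) [IsProbabilityMeasure P] {L : Ω → ℝ≥0}
    (hL : Measurable L) (hc : Continuous (distFun (law P L))) (X : Ω → ℝ≥0) :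
    ∀ᵐ ω ∂P, (rearrangement P L X ω : ℝ≥0∞)
      = quantile (law P X) (distFun (law P L) (L ω)) := by
  filter_upwards [ae_distFun_mem_Ioo P hL hc] with ω hω
  exact ENNReal.coe_toNNReal (quantile_lt_top _ hω.2).ne

theorem rearrangement_nondecreasing (P : Measure Ω) [IsProbabilityMeasure P] {L : Ω → ℝ≥0}
    (hL : Measurable L) (hc : Continuous (distFun (law P L))) (X : Ω → ℝ≥0) :
    ∃ A : Set Ω, (∀ᵐ ω ∂P, ω ∈ A) ∧ ∀ ω ∈ A, ∀ ω' ∈ A, L ω ≤ L ω' →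
      rearrangement P L X ω ≤ rearrangement P L X ω' := by
  refine ⟨_, coe_rearrangement P hL hc X, fun ω h ω' h' hle => ?_⟩
  rw [← ENNReal.coe_le_coe]
  rw [show _ = _ from h, show _ = _ from h']
  exact quantile_mono _ (distFun_mono _ (by exact_mod_cast hle))

/-- The Galois connection of the quantile, with one null set for all thresholds. It determines the
law of the rearrangement and later the supergradients of the utility. -/
theorem lt_rearrangement_iff (P : Measure Ω) [IsProbabilityMeasure P] {L : Ω → ℝ≥0}
    (hL : Measurable L) (hc : Continuous (distFun (law P L))) {X : Ω → ℝ≥0}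
    (hX : Measurable X) :
    ∀ᵐ ω ∂P, ∀ t : ℝ, t < (rearrangement P L X ω : ℝ) ↔
      distFun (law P X) t < distFun (law P L) (L ω) := by
  filter_upwards [ae_distFun_mem_Ioo P hL hc, coe_rearrangement P hL hc X] with ω h01 hω t
  by_cases ht : t < 0
  · have h0 : distFun (law P X) t = 0 := by
      rw [distFun_law P hX]
      have : {ω | (X ω : ℝ) ≤ t} = ∅ := by
        ext ω; simp only [Set.mem_ofPred_eq, Set.mem_empty_iff_false, iff_false, not_le]
        exact ht.trans_le (X ω).2
      simp [this]
    rw [h0]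
    exact iff_of_true (ht.trans_le (NNReal.coe_nonneg _)) h01.1
  · lift t to ℝ≥0 using not_lt.1 ht
    rw [← not_le, ← not_le, NNReal.coe_le_coe, ← quantile_le_iff, ← hω, ENNReal.coe_le_coe]

theorem law_rearrangement (P : Measure Ω) [IsProbabilityMeasure P] {L : Ω → ℝ≥0}
    (hL : Measurable L) (hc : Continuous (distFun (law P L))) {X : Ω → ℝ≥0}
    (hX : Measurable X) : law P (rearrangement P L X) = law P X := by
  refine law_eq_of_measure_lt (measurable_rearrangement P hL X) hX fun t => ?_
  have hm : Measurable fun ω => distFun (law P L) (L ω) := hc.measurable.comp (by fun_prop)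
  have h1 : {ω | (t : ℝ) < rearrangement P L X ω} =ᵐ[P]
      ({ω | distFun (law P L) (L ω) ≤ distFun (law P X) t}ᶜ : Set Ω) := by
    filter_upwards [lt_rearrangement_iff P hL hc hX] with ω hω
    exact propext ((hω t).trans not_le.symm)
  rw [measureReal_congr h1, probReal_compl_eq_one_sub (measurableSet_le hm measurable_const),
    measureReal_distFun_le P hL hc (distFun_nonneg _ _) (distFun_le_one _ _),
    measureReal_lt_eq_one_sub_distFun P hX]

end Distributions

/-! ### The Neyman-Pearson argument -/

section NeymanPearson

variable {Ω : Type*} [MeasurableSpace Ω]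

/-- Among all events that are at least as `P`-likely as an upper set `B` of the likelihood
ratio `L`, the event `B` has the least `Q`-probability. -/
theorem neyman_pearson {P Q : Measure Ω} [IsFiniteMeasure P] [IsFiniteMeasure Q]
    {L : Ω → ℝ≥0} (hPL : ∀ s, MeasurableSet s → P s = ∫⁻ ω in s, L ω ∂Q)
    (hQP : Q ≪ P) (hPQ : P ≪ Q) (hatom : ∀ a : ℝ≥0, P {ω | L ω = a} = 0)
    {A B D : Set Ω} (hA : MeasurableSet A) (hB : MeasurableSet B) (hD : ∀ᵐ ω ∂P, ω ∈ D)
    (hup : ∀ ω ∈ D, ∀ ω' ∈ D, L ω ≤ L ω' → ω ∈ B → ω' ∈ B) (hle : P B ≤ P A) :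
    Q B ≤ Q A ∧ (Q A = Q B → A =ᵐ[P] B) := by
  have hDQ : ∀ᵐ ω ∂Q, ω ∈ D := hQP.ae_le hD
  have hPd : P (B \ A) ≤ P (A \ B) := by
    have h1 := measure_inter_add_sdiff (μ := P) B hA
    have h2 := measure_inter_add_sdiff (μ := P) A hB
    rw [← h1, ← h2, Set.inter_comm A B] at hle
    exact (ENNReal.add_le_add_iff_left (by finiteness)).1 hle
  have hQB : Q B = Q (B ∩ A) + Q (B \ A) := (measure_inter_add_sdiff (μ := Q) B hA).symm
  have hQA : Q A = Q (B ∩ A) + Q (A \ B) := by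
    rw [Set.inter_comm]; exact (measure_inter_add_sdiff (μ := Q) A hB).symm
  -- The common part of the two events cancels; only the differences matter.
  suffices h : Q (B \ A) ≤ Q (A \ B) ∧ (Q (A \ B) = Q (B \ A) → Q (A \ B) = 0) by
    refine ⟨by rw [hQA, hQB]; exact add_le_add_right h.1 _, fun heq => ?_⟩
    rw [hQA, hQB] at heq
    have heq' := (ENNReal.add_right_inj (by finiteness)).1 heq
    have h0 := h.2 heq'
    rw [ae_eq_set]
    exact ⟨hPQ h0, hPQ (heq' ▸ h0)⟩
  by_cases hne : (B ∩ D).Nonempty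
  · set a : ℝ≥0 := sInf (L '' (B ∩ D)) with ha
    have hlow : ∀ ω ∈ B ∩ D, a ≤ L ω := fun ω hω => csInf_le (OrderBot.bddBelow _) ⟨ω, hω, rfl⟩
    have hupp : ∀ ω ∈ D, ω ∉ B → L ω ≤ a := by
      intro ω hωD hωB
      refine le_csInf (hne.image _) ?_
      rintro _ ⟨ω', hω', rfl⟩
      by_contra hlt
      exact hωB (hup ω' hω'.2 ω hωD (not_le.1 hlt).le hω'.1)
    have e1 : P (A \ B) ≤ a * Q (A \ B) := by
      rw [hPL _ (hA.diff hB), ← setLIntegral_const]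
      refine setLIntegral_mono_ae' (hA.diff hB) ?_
      filter_upwards [hDQ] with ω hω hAB
      exact_mod_cast hupp ω hω hAB.2
    have e2 : a * Q (B \ A) ≤ P (B \ A) := by
      rw [hPL _ (hB.diff hA), ← setLIntegral_const]
      refine setLIntegral_mono_ae' (hB.diff hA) ?_
      filter_upwards [hDQ] with ω hω hAB
      exact_mod_cast hlow ω ⟨hAB.1, hω⟩
    -- Cancelling the factor `a` requires it to be nonzero; if it vanishes, both differences are
    -- null.
    by_cases ha0 : a = 0
    · have z1 : P (A \ B) = 0 := by simpa [ha0] using e1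
      have z2 : P (B \ A) = 0 := by rw [z1] at hPd; simpa using hPd
      rw [hQP z1, hQP z2]
      simp
    · have hane : (a : ℝ≥0∞) ≠ 0 := by exact_mod_cast ha0
      refine ⟨?_, fun heq => ?_⟩
      · have := (e2.trans hPd).trans e1
        exact (ENNReal.mul_le_mul_iff_right hane ENNReal.coe_ne_top).1 this
      · have hPa : P (A \ B) = a * Q (A \ B) :=
          le_antisymm e1 (by rw [heq]; exact e2.trans hPd)
        -- Equal costs force `L = a` almost everywhere on `A \ B`, which is null because `L` has no
        -- atoms.
        have hint : ∫⁻ ω in A \ B, (L ω : ℝ≥0∞) ∂Q = ∫⁻ _ in A \ B, (a : ℝ≥0∞) ∂Q := by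
          rw [← hPL _ (hA.diff hB), hPa, setLIntegral_const]
        have hae : ∀ᵐ ω ∂(Q.restrict (A \ B)), (L ω : ℝ≥0∞) ≤ a := by
          rw [ae_restrict_iff' (hA.diff hB)]
          filter_upwards [hDQ] with ω hω hAB
          exact_mod_cast hupp ω hω hAB.2
        have hEq := ae_eq_of_ae_le_of_lintegral_le hae
          (by rw [← hPL _ (hA.diff hB)]; finiteness) measurable_const.aemeasurable hint.ge
        rw [Filter.EventuallyEq, ae_restrict_iff' (hA.diff hB)] at hEq
        have hnat : ∀ᵐ ω ∂Q, ω ∉ {ω | L ω = a} :=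
          measure_eq_zero_iff_ae_notMem.1 (hQP (hatom a))
        rw [measure_eq_zero_iff_ae_notMem]
        filter_upwards [hEq, hnat] with ω h1 h2 h3
        exact h2 (by exact_mod_cast h1 h3)
  · have hPB : P B = 0 := by
      rw [measure_eq_zero_iff_ae_notMem]
      filter_upwards [hD] with ω hω hωB
      exact hne ⟨ω, hωB, hω⟩
    have hQB0 : Q (B \ A) = 0 := measure_mono_null Set.sdiff_subset (hQP hPB)
    rw [hQB0]
    exact ⟨by simp, id⟩

/-- A random variable that is nondecreasing in the likelihood ratio `L` has the least
`Q`-expectation among all random variables that stochastically dominate it under `P`, and it is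
the only one with this expectation. -/
theorem lintegral_le_of_nondecreasing {P Q : Measure Ω} [IsFiniteMeasure P] [IsFiniteMeasure Q]
    {L : Ω → ℝ≥0} (hPL : ∀ s, MeasurableSet s → P s = ∫⁻ ω in s, L ω ∂Q)
    (hQP : Q ≪ P) (hPQ : P ≪ Q) (hatom : ∀ a : ℝ≥0, P {ω | L ω = a} = 0)
    {X Y : Ω → ℝ≥0} (hX : Measurable X) (hY : Measurable Y)
    (hmono : ∃ A : Set Ω, (∀ᵐ ω ∂P, ω ∈ A) ∧ ∀ ω ∈ A, ∀ ω' ∈ A, L ω ≤ L ω' → Y ω ≤ Y ω')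
    (hdom : ∀ t : ℝ, P {ω | t < (Y ω : ℝ)} ≤ P {ω | t < (X ω : ℝ)}) :
    ∫⁻ ω, Y ω ∂Q ≤ ∫⁻ ω, X ω ∂Q ∧
      (∫⁻ ω, Y ω ∂Q ≠ ⊤ → ∫⁻ ω, X ω ∂Q ≤ ∫⁻ ω, Y ω ∂Q → X =ᵐ[P] Y) := by
  obtain ⟨D, hD, hD'⟩ := hmono
  -- The layer-cake formula reduces expectations to the tail events, to which the Neyman-Pearson
  -- bound applies one level at a time.
  have hcake : ∀ Z : Ω → ℝ≥0, Measurable Z →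
      ∫⁻ ω, Z ω ∂Q = ∫⁻ t in Set.Ioi (0 : ℝ), Q {ω | t < (Z ω : ℝ)} := by
    intro Z hZ
    rw [← lintegral_eq_lintegral_meas_lt (f := fun ω => (Z ω : ℝ)) Q
      (Filter.Eventually.of_forall fun ω => (Z ω).2)
      (by fun_prop)]
    simp
  have hms : ∀ (Z : Ω → ℝ≥0), Measurable Z → ∀ t : ℝ, MeasurableSet {ω | t < (Z ω : ℝ)} :=
    fun Z hZ t => measurableSet_lt (by fun_prop) (by fun_prop)
  have hNP := fun t : ℝ => neyman_pearson hPL hQP hPQ hatom (hms X hX t) (hms Y hY t) hD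
    (fun ω hω ω' hω' hl (hlt : t < (Y ω : ℝ)) =>
      show t < (Y ω' : ℝ) from hlt.trans_le (by exact_mod_cast hD' ω hω ω' hω' hl)) (hdom t)
  rw [hcake X hX, hcake Y hY]
  refine ⟨lintegral_mono fun t => (hNP t).1, fun hfin hle => ?_⟩
  have hanti : ∀ Z : Ω → ℝ≥0, Antitone fun t : ℝ => Q {ω | t < (Z ω : ℝ)} :=
    fun Z s t hst => measure_mono fun ω (hω : t < (Z ω : ℝ)) => lt_of_le_of_lt hst hω
  have hae := ae_eq_of_ae_le_of_lintegral_le (μ := volume.restrict (Set.Ioi (0 : ℝ)))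
    (Filter.Eventually.of_forall fun t => (hNP t).1) hfin (hanti X).measurable.aemeasurable hle
  rw [Filter.EventuallyEq, ae_restrict_iff' measurableSet_Ioi] at hae
  -- The tail events agree only for almost every level, but every rational interval contains such a
  -- level. Countably many of them suffice to separate the values of `X` and `Y`.
  have hgood : ∀ p q : ℚ, p < q → 0 ≤ p → ∃ t : ℝ, p < t ∧ t < q ∧
      ∀ᵐ ω ∂P, t < (X ω : ℝ) ↔ t < (Y ω : ℝ) := by
    intro p q hpq hp
    have hpos : volume (Set.Ioo (p : ℝ) q) ≠ 0 := by
      rw [Real.volume_Ioo]; simpa using hpq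
    obtain ⟨t, ht, htt⟩ : ∃ t ∈ Set.Ioo (p : ℝ) q, t ∈ Set.Ioi (0 : ℝ) →
        Q {ω | t < (Y ω : ℝ)} = Q {ω | t < (X ω : ℝ)} := by
      by_contra! hcon
      exact hpos (measure_mono_null (fun t ht => fun h => (hcon t ht).2 (h (hcon t ht).1))
        (ae_iff.1 hae))
    have ht0 : t ∈ Set.Ioi (0 : ℝ) := lt_of_le_of_lt (by exact_mod_cast hp) ht.1
    exact ⟨t, ht.1, ht.2, ((hNP t).2 (htt ht0).symm).mem_iff⟩
  have hall : ∀ᵐ ω ∂P, ∀ p q : ℚ, p < q → 0 ≤ p → ∃ t : ℝ, p < t ∧ t < q ∧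
      (t < (X ω : ℝ) ↔ t < (Y ω : ℝ)) := by
    refine ae_all_iff.2 fun p => ae_all_iff.2 fun q => ?_
    by_cases h : p < q ∧ 0 ≤ p
    · obtain ⟨t, h1, h2, h3⟩ := hgood p q h.1 h.2
      filter_upwards [h3] with ω hω _ _
      exact ⟨t, h1, h2, hω⟩
    · exact Filter.Eventually.of_forall fun ω h1 h2 => absurd ⟨h1, h2⟩ h
  have key : ∀ x y : ℝ≥0, x < y → ∃ p q : ℚ, p < q ∧ 0 ≤ p ∧ (x : ℝ) < p ∧ (q : ℝ) < y := by
    intro x y hxy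
    obtain ⟨p, hp1, hp2⟩ := exists_rat_btwn (NNReal.coe_lt_coe.2 hxy)
    obtain ⟨q, hq1, hq2⟩ := exists_rat_btwn hp2
    refine ⟨p, q, by exact_mod_cast hq1, ?_, hp1, hq2⟩
    have : (0 : ℝ) ≤ p := x.2.trans hp1.le
    exact_mod_cast this
  filter_upwards [hall] with ω hω
  rcases lt_trichotomy (X ω) (Y ω) with h | h | h
  · obtain ⟨p, q, hpq, h0, hp, hq⟩ := key _ _ h
    obtain ⟨t, ht1, ht2, ht⟩ := hω p q hpq h0
    have := ht.2 (ht2.trans hq)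
    linarith
  · exact h
  · obtain ⟨p, q, hpq, h0, hp, hq⟩ := key _ _ h
    obtain ⟨t, ht1, ht2, ht⟩ := hω p q hpq h0
    have := ht.1 (ht2.trans hq)
    linarith

end NeymanPearson

/-! ### First-order stochastic dominance -/

section StochasticDominance

variable {Ω : Type*} [MeasurableSpace Ω]

theorem integral_le_of_tail_le {P P' : Measure Ω} [IsProbabilityMeasure P]
    [IsProbabilityMeasure P'] {f : Ω → ℝ} (hf : Measurable f) (hi : Integrable f P)
    (hi' : Integrable f P') (h : ∀ t : ℝ, P {ω | t < f ω} ≤ P' {ω | t < f ω}) :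
    ∫ ω, f ω ∂P ≤ ∫ ω, f ω ∂P' := by
  have hpos : ∫⁻ ω, ENNReal.ofReal (f ω) ∂P ≤ ∫⁻ ω, ENNReal.ofReal (f ω) ∂P' := by
    have hcake : ∀ ν : Measure Ω, ∫⁻ ω, ENNReal.ofReal (f ω) ∂ν
        = ∫⁻ t in Set.Ioi (0 : ℝ), ν {ω | t < max (f ω) 0} := by
      intro ν
      rw [← lintegral_eq_lintegral_meas_lt (f := fun ω => max (f ω) 0) ν
        (Filter.Eventually.of_forall fun ω => le_max_right _ _)
        (by fun_prop)]
      simp [ENNReal.ofReal_max]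
    rw [hcake, hcake]
    refine setLIntegral_mono' measurableSet_Ioi fun t (ht : 0 < t) => ?_
    simpa [lt_max_iff, ht.not_gt] using h t
  -- With the non-strict layer-cake formula, the level sets of the negative part are complements of
  -- strict upper tails; equal total mass reverses the inequality.
  have hneg : ∫⁻ ω, ENNReal.ofReal (-f ω) ∂P' ≤ ∫⁻ ω, ENNReal.ofReal (-f ω) ∂P := by
    have hcake : ∀ ν : Measure Ω, ∫⁻ ω, ENNReal.ofReal (-f ω) ∂ν
        = ∫⁻ t in Set.Ioi (0 : ℝ), ν {ω | t ≤ max (-f ω) 0} := by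
      intro ν
      rw [← lintegral_eq_lintegral_meas_le (f := fun ω => max (-f ω) 0) ν
        (Filter.Eventually.of_forall fun ω => le_max_right _ _)
        (by fun_prop)]
      simp [ENNReal.ofReal_max]
    rw [hcake, hcake]
    refine setLIntegral_mono' measurableSet_Ioi fun t (ht : 0 < t) => ?_
    have hset : {ω | t ≤ max (-f ω) 0} = {ω | -t < f ω}ᶜ := by
      ext ω
      simp only [le_max_iff, ht.not_ge, or_false, Set.mem_ofPred_eq, Set.mem_compl_iff, not_lt]
      exact le_neg
    have hms : MeasurableSet {ω | -t < f ω} := measurableSet_lt measurable_const hf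
    rw [hset, prob_compl_eq_one_sub hms, prob_compl_eq_one_sub hms]
    exact tsub_le_tsub_left (h _) _
  rw [integral_eq_lintegral_pos_part_sub_lintegral_neg_part hi,
    integral_eq_lintegral_pos_part_sub_lintegral_neg_part hi']
  have f1 : ∫⁻ ω, ENNReal.ofReal (f ω) ∂P' ≠ ⊤ := hi'.lintegral_lt_top.ne
  have f2 : ∫⁻ ω, ENNReal.ofReal (-f ω) ∂P ≠ ⊤ := hi.neg.lintegral_lt_top.ne
  exact sub_le_sub (ENNReal.toReal_mono f1 hpos) (ENNReal.toReal_mono f2 hneg)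

/-- If `P` is least favorable for `L` with respect to first-order dominance, it is least favorable
for everything that is nondecreasing in `L`. -/
theorem integralOrder_FSD_of_nondecreasing {P P' : Measure Ω} [IsProbabilityMeasure P]
    [IsProbabilityMeasure P'] (hac : P' ≪ P) {L Y : Ω → ℝ≥0} (hL : Measurable L)
    (hY : Measurable Y) (hmono : ∃ A : Set Ω, (∀ᵐ ω ∂P, ω ∈ A) ∧
      ∀ ω ∈ A, ∀ ω' ∈ A, L ω ≤ L ω' → Y ω ≤ Y ω')
    (h : IntegralOrder FSD (law P L) (law P' L)) :
    IntegralOrder FSD (law P Y) (law P' Y) := by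
  obtain ⟨A, hA, hA'⟩ := hmono
  intro f hf hi hi'
  have hfm : Measurable f := Monotone.measurable hf
  have hi2 : Integrable (fun ω => f (Y ω)) P :=
    (integrable_map_measure hfm.aestronglyMeasurable hY.aemeasurable).1 hi
  have hi2' : Integrable (fun ω => f (Y ω)) P' :=
    (integrable_map_measure hfm.aestronglyMeasurable hY.aemeasurable).1 hi'
  rw [law, law, integral_map hY.aemeasurable hfm.aestronglyMeasurable,
    integral_map hY.aemeasurable hfm.aestronglyMeasurable]
  refine integral_le_of_tail_le (hfm.comp hY) hi2 hi2' fun t => ?_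
  -- On `A` the event `t < f (Y ω)` is the preimage under `L` of this upper set, whose indicator is
  -- a nondecreasing test function for the law of `L`.
  set D : Set ℝ≥0 := {x | ∃ ω ∈ A, t < f (Y ω) ∧ L ω ≤ x} with hDdef
  have hup : IsUpperSet D := fun x y hxy ⟨ω, h1, h2, h3⟩ => ⟨ω, h1, h2, h3.trans hxy⟩
  have hDm : MeasurableSet D := hup.ordConnected.measurableSet
  have hchar : ∀ ω ∈ A, (t < f (Y ω) ↔ L ω ∈ D) := by
    intro ω hω
    refine ⟨fun ht => ⟨ω, hω, ht, le_rfl⟩, ?_⟩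
    rintro ⟨ω', h1, h2, h3⟩
    exact h2.trans_le (hf (hA' ω' h1 ω hω h3))
  have key : ∀ ν : Measure Ω, (∀ᵐ ω ∂ν, ω ∈ A) → ν {ω | t < f (Y ω)} = law ν L D := by
    intro ν hν
    rw [law, Measure.map_apply hL hDm]
    refine measure_congr ?_
    filter_upwards [hν] with ω hω
    exact propext (hchar ω hω)
  rw [key P hA, key P' (hac.ae_le hA)]
  have : IsProbabilityMeasure (law P L) := Measure.isProbabilityMeasure_map hL.aemeasurable
  have : IsProbabilityMeasure (law P' L) := Measure.isProbabilityMeasure_map hL.aemeasurable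
  have hind : D.indicator (fun _ => (1 : ℝ)) ∈ FSD := by
    intro x y hxy
    by_cases hx : x ∈ D
    · simp [hx, hup hxy hx]
    · rw [Set.indicator_of_notMem hx]
      exact Set.indicator_nonneg (fun _ _ => zero_le_one) _
  have hint : ∀ ν : Measure ℝ≥0, IsProbabilityMeasure ν →
      Integrable (D.indicator (fun _ => (1 : ℝ))) ν :=
    fun ν _ => (integrable_const 1).indicator hDm
  have := h _ hind (hint _ inferInstance) (hint _ inferInstance)
  rw [integral_indicator_const _ hDm, integral_indicator_const _ hDm] at this
  simp only [smul_eq_mul, mul_one] at this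
  exact (ENNReal.toReal_le_toReal (by finiteness) (by finiteness)).1 this

end StochasticDominance

/-! ### Integrals of nonincreasing functions -/

section Concave

variable {k : ℝ → ℝ≥0∞}

theorem setLIntegral_Icc_add (k : ℝ → ℝ≥0∞) {a b d : ℝ} (hab : a ≤ b) (hbd : b ≤ d) :
    (∫⁻ y in Set.Icc a b, k y) + (∫⁻ y in Set.Icc b d, k y) = ∫⁻ y in Set.Icc a d, k y := by
  rw [← Set.Icc_union_Ioc_eq_Icc hab hbd, lintegral_union measurableSet_Ioc,
    setLIntegral_congr (Ioc_ae_eq_Icc (a := b) (b := d))]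
  exact Set.disjoint_left.2 fun y h1 h2 => h2.1.not_ge h1.2

theorem setLIntegral_Icc_of_le (k : ℝ → ℝ≥0∞) {a b : ℝ} (hab : b ≤ a) :
    ∫⁻ y in Set.Icc a b, k y = 0 := by
  refine setLIntegral_measure_zero _ _ ?_
  rw [Real.volume_Icc]
  simpa using hab

/-- A subtraction-free form of $\int_c^z-\int_c^x=\int_x^z$, valid even when some of the integrals
are infinite. -/
theorem setLIntegral_Icc_shift (k : ℝ → ℝ≥0∞) (c : ℝ) {x z : ℝ} (hxz : x ≤ z) :
    (∫⁻ y in Set.Icc c x, k y) + (∫⁻ y in Set.Icc z c, k y) + ∫⁻ y in Set.Icc x z, k y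
      = (∫⁻ y in Set.Icc c z, k y) + ∫⁻ y in Set.Icc x c, k y := by
  rcases le_total c x with h | h
  · rw [setLIntegral_Icc_of_le k (h.trans hxz), setLIntegral_Icc_of_le k h, add_zero, add_zero,
      setLIntegral_Icc_add k h hxz]
  · rw [setLIntegral_Icc_of_le k h, zero_add]
    rcases le_total c z with h' | h'
    · rw [setLIntegral_Icc_of_le k h', zero_add, ← setLIntegral_Icc_add k h h', add_comm]
    · rw [setLIntegral_Icc_of_le k h', zero_add, ← setLIntegral_Icc_add k hxz h', add_comm]

theorem mul_le_setLIntegral_Icc {s : ℝ≥0∞} {a b : ℝ} (h : ∀ y, y < b → s ≤ k y) :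
    s * ENNReal.ofReal (b - a) ≤ ∫⁻ y in Set.Icc a b, k y := by
  rw [← Real.volume_Ico, ← setLIntegral_const, setLIntegral_congr Ico_ae_eq_Icc.symm]
  exact setLIntegral_mono' measurableSet_Ico fun y hy => h y hy.2

theorem setLIntegral_Icc_le_mul {s : ℝ≥0∞} {a b : ℝ} (h : ∀ y, a ≤ y → k y ≤ s) :
    ∫⁻ y in Set.Icc a b, k y ≤ s * ENNReal.ofReal (b - a) := by
  rw [← Real.volume_Icc, ← setLIntegral_const]
  exact setLIntegral_mono' measurableSet_Icc fun y hy => h y hy.1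

/-- If `s` is a supergradient at `z`, the tangent line with slope `s` at `z` lies above the
concave function `x ↦ ∫_c^x k`. -/
theorem tangent_le {s z x : ℝ≥0} (c : ℝ) (hlow : ∀ y : ℝ, y < z → (s : ℝ≥0∞) ≤ k y)
    (hup : ∀ y : ℝ, z ≤ y → k y ≤ s) :
    (∫⁻ y in Set.Icc c x, k y) + (s * z + ∫⁻ y in Set.Icc (z : ℝ) c, k y)
      ≤ (∫⁻ y in Set.Icc c z, k y) + (s * x + ∫⁻ y in Set.Icc (x : ℝ) c, k y) := by
  rcases le_total x z with h | h
  · have hI := setLIntegral_Icc_shift k c (NNReal.coe_le_coe.2 h)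
    have hz : (z : ℝ≥0∞) = ENNReal.ofReal ((z : ℝ) - x) + x := by
      rw [← NNReal.coe_sub h, ENNReal.ofReal_coe_nnreal]
      exact_mod_cast (tsub_add_cancel_of_le h).symm
    calc _ = ((∫⁻ y in Set.Icc c x, k y) + (∫⁻ y in Set.Icc (z : ℝ) c, k y)
          + s * ENNReal.ofReal ((z : ℝ) - x)) + s * x := by rw [hz]; ring
      _ ≤ ((∫⁻ y in Set.Icc c x, k y) + (∫⁻ y in Set.Icc (z : ℝ) c, k y)
          + ∫⁻ y in Set.Icc (x : ℝ) z, k y) + s * x := by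
        gcongr; exact mul_le_setLIntegral_Icc hlow
      _ = _ := by rw [hI]; ring
  · have hI := setLIntegral_Icc_shift k c (NNReal.coe_le_coe.2 h)
    have hx : (x : ℝ≥0∞) = ENNReal.ofReal ((x : ℝ) - z) + z := by
      rw [← NNReal.coe_sub h, ENNReal.ofReal_coe_nnreal]
      exact_mod_cast (tsub_add_cancel_of_le h).symm
    calc _ = ((∫⁻ y in Set.Icc c x, k y) + ∫⁻ y in Set.Icc (z : ℝ) c, k y) + s * z := by ring
      _ = ((∫⁻ y in Set.Icc c z, k y) + (∫⁻ y in Set.Icc (x : ℝ) c, k y)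
          + ∫⁻ y in Set.Icc (z : ℝ) x, k y) + s * z := by rw [hI]
      _ ≤ ((∫⁻ y in Set.Icc c z, k y) + (∫⁻ y in Set.Icc (x : ℝ) c, k y)
          + s * ENNReal.ofReal ((x : ℝ) - z)) + s * z := by
        gcongr; exact setLIntegral_Icc_le_mul hup
      _ = _ := by rw [hx]; ring

/-- Equality in the tangent inequality means that `k` is equal to `s` between `x` and `z`. -/
theorem exists_rat_eq_of_tangent_eq (hk : Antitone k) {s z x : ℝ≥0} (c : ℝ)
    (hlow : ∀ y : ℝ, y < z → (s : ℝ≥0∞) ≤ k y) (hup : ∀ y : ℝ, z ≤ y → k y ≤ s) (hne : x ≠ z)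
    (hz1 : ∫⁻ y in Set.Icc c z, k y ≠ ⊤) (hz2 : ∫⁻ y in Set.Icc (z : ℝ) c, k y ≠ ⊤)
    (hx1 : ∫⁻ y in Set.Icc c x, k y ≠ ⊤) (hx2 : ∫⁻ y in Set.Icc (x : ℝ) c, k y ≠ ⊤)
    (heq : (∫⁻ y in Set.Icc c x, k y) + (s * z + ∫⁻ y in Set.Icc (z : ℝ) c, k y)
      = (∫⁻ y in Set.Icc c z, k y) + (s * x + ∫⁻ y in Set.Icc (x : ℝ) c, k y)) :
    ∃ q : ℚ, k q = s := by
  have hsplit : ∀ {a b r : ℝ}, a < r → r < b → ENNReal.ofReal (b - a)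
      = ENNReal.ofReal (r - a) + ENNReal.ofReal (b - r) := by
    intro a b r h1 h2
    rw [← ENNReal.ofReal_add (by linarith) (by linarith)]; congr 1; ring
  rcases lt_or_gt_of_ne hne with h | h
  · have h' := NNReal.coe_lt_coe.2 h
    -- If `k q` exceeded `s`, antitonicity would keep `k` above it all the way from `x` to `q`,
    -- making the tangent inequality strict. A rational point is chosen so that only countably many
    -- slopes have to be excluded later.
    obtain ⟨q, hq1, hq2⟩ := exists_rat_btwn h'
    refine ⟨q, le_antisymm ?_ (hlow q hq2)⟩
    by_contra hlt
    rw [not_le] at hlt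
    have hI := setLIntegral_Icc_shift k c h'.le
    have hz : (z : ℝ≥0∞) = ENNReal.ofReal ((z : ℝ) - x) + x := by
      rw [← NNReal.coe_sub h.le, ENNReal.ofReal_coe_nnreal]
      exact_mod_cast (tsub_add_cancel_of_le h.le).symm
    have hval : ∫⁻ y in Set.Icc (x : ℝ) z, k y = s * ENNReal.ofReal ((z : ℝ) - x) := by
      have e : ((∫⁻ y in Set.Icc c x, k y) + (∫⁻ y in Set.Icc (z : ℝ) c, k y) + s * x)
          + s * ENNReal.ofReal ((z : ℝ) - x)
          = ((∫⁻ y in Set.Icc c x, k y) + (∫⁻ y in Set.Icc (z : ℝ) c, k y) + s * x)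
          + ∫⁻ y in Set.Icc (x : ℝ) z, k y := by
        rw [hz] at heq
        calc _ = _ := by rw [← add_assoc, mul_add] at heq; rw [← add_assoc] at heq; ring
          _ = _ := heq
          _ = _ := by rw [← add_assoc, add_right_comm, ← hI]; ring
      exact ((ENNReal.add_right_inj (by finiteness)).1 e).symm
    have hbig : s * ENNReal.ofReal ((z : ℝ) - x) < ∫⁻ y in Set.Icc (x : ℝ) z, k y := by
      rw [← setLIntegral_Icc_add k hq1.le hq2.le, hsplit hq1 hq2, mul_add]
      refine ENNReal.add_lt_add_of_lt_of_le (by finiteness) ?_ (mul_le_setLIntegral_Icc hlow)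
      calc (s : ℝ≥0∞) * ENNReal.ofReal (q - x) < k q * ENNReal.ofReal (q - x) := by
            refine ENNReal.mul_lt_mul_left (by simpa using hq1) (by finiteness) hlt
        _ ≤ _ := mul_le_setLIntegral_Icc fun y hy => hk hy.le
    exact absurd hval hbig.ne'
  · have h' := NNReal.coe_lt_coe.2 h
    obtain ⟨q, hq1, hq2⟩ := exists_rat_btwn h'
    refine ⟨q, le_antisymm (hup q hq1.le) ?_⟩
    by_contra hlt
    rw [not_le] at hlt
    have hI := setLIntegral_Icc_shift k c h'.le
    have hx : (x : ℝ≥0∞) = ENNReal.ofReal ((x : ℝ) - z) + z := by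
      rw [← NNReal.coe_sub h.le, ENNReal.ofReal_coe_nnreal]
      exact_mod_cast (tsub_add_cancel_of_le h.le).symm
    have hval : ∫⁻ y in Set.Icc (z : ℝ) x, k y = s * ENNReal.ofReal ((x : ℝ) - z) := by
      have e : ((∫⁻ y in Set.Icc c z, k y) + (∫⁻ y in Set.Icc (x : ℝ) c, k y) + s * z)
          + ∫⁻ y in Set.Icc (z : ℝ) x, k y
          = ((∫⁻ y in Set.Icc c z, k y) + (∫⁻ y in Set.Icc (x : ℝ) c, k y) + s * z)
          + s * ENNReal.ofReal ((x : ℝ) - z) := by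
        rw [hx] at heq
        calc _ = _ := by rw [add_right_comm, hI]; ring
          _ = _ := heq
          _ = _ := by ring
      exact (ENNReal.add_right_inj (by finiteness)).1 e
    have hsmall : ∫⁻ y in Set.Icc (z : ℝ) x, k y < s * ENNReal.ofReal ((x : ℝ) - z) := by
      rw [← setLIntegral_Icc_add k hq1.le hq2.le, hsplit hq1 hq2, mul_add]
      have hle := setLIntegral_Icc_le_mul (b := q) hup
      refine ENNReal.add_lt_add_of_le_of_lt (ne_top_of_le_ne_top (by finiteness) hle) hle ?_
      calc ∫⁻ y in Set.Icc (q : ℝ) x, k y ≤ k q * ENNReal.ofReal (x - q) :=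
            setLIntegral_Icc_le_mul fun y hy => hk hy
        _ < _ := ENNReal.mul_lt_mul_left (by simpa using hq2) (by finiteness) hlt
    exact absurd hval hsmall.ne

/-! ### Truncated utilities -/

/-- `x ↦ ∫_c^x min(k, n)`. -/
noncomputable def truncUtil (k : ℝ → ℝ≥0∞) (c : ℝ) (n : ℕ) (x : ℝ≥0) : ℝ :=
  ∫ y in c..x, (min (k y) n).toReal

theorem antitone_trunc (hk : Antitone k) (n : ℕ) : Antitone fun y => (min (k y) n).toReal :=
  fun _ _ h => ENNReal.toReal_mono (ne_top_of_le_ne_top (by finiteness) (min_le_right _ _))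
    (min_le_min_right _ (hk h))

/-- The slope at `z` bounds the antitone integrand from the appropriate side on either side of `z`.
Monotonicity and concavity are both read off from this inequality. -/
theorem truncUtil_le_tangent (hk : Antitone k) (c : ℝ) (n : ℕ) (x z : ℝ≥0) :
    truncUtil k c n x ≤ truncUtil k c n z + (min (k z) n).toReal * (x - z) := by
  have hanti := antitone_trunc hk n
  have hii : ∀ a b : ℝ, IntervalIntegrable (fun y => (min (k y) n).toReal) volume a b :=
    fun a b => hanti.intervalIntegrable
  have hsub : truncUtil k c n x - truncUtil k c n z = ∫ y in (z : ℝ)..x, (min (k y) n).toReal :=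
    intervalIntegral.integral_interval_sub_left (hii _ _) (hii _ _)
  rcases le_total x z with h | h
  · have h1 : ∫ y in (x : ℝ)..z, (min (k z) n).toReal ≤ ∫ y in (x : ℝ)..z, (min (k y) n).toReal :=
      intervalIntegral.integral_mono_on (NNReal.coe_le_coe.2 h) (by simp) (hii _ _)
        fun y hy => hanti hy.2
    rw [intervalIntegral.integral_symm] at hsub
    simp only [intervalIntegral.integral_const, smul_eq_mul] at h1
    linarith
  · have h1 : ∫ y in (z : ℝ)..x, (min (k y) n).toReal ≤ ∫ y in (z : ℝ)..x, (min (k z) n).toReal :=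
      intervalIntegral.integral_mono_on (NNReal.coe_le_coe.2 h) (hii _ _) (by simp)
        fun y hy => hanti hy.1
    simp only [intervalIntegral.integral_const, smul_eq_mul] at h1
    linarith

theorem truncUtil_mem_SSD (hk : Antitone k) (c : ℝ) (n : ℕ) : truncUtil k c n ∈ SSD := by
  constructor
  · intro x z h
    have := truncUtil_le_tangent hk c n x z
    have h2 : (x : ℝ) ≤ z := h
    have h3 : 0 ≤ (min (k z) n).toReal := ENNReal.toReal_nonneg
    nlinarith
  · refine ⟨convex_univ, fun x _ z _ a b _ _ hab => ?_⟩
    set w := a • x + b • z with hw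
    have h1 := truncUtil_le_tangent hk c n x w
    have h2 := truncUtil_le_tangent hk c n z w
    have hab' : (a : ℝ) + b = 1 := by exact_mod_cast hab
    have hw' : (w : ℝ) = a * x + b * z := by rw [hw]; simp
    have e : a • truncUtil k c n x + b • truncUtil k c n z
        ≤ (a : ℝ) * (truncUtil k c n w + (min (k w) n).toReal * (x - w))
          + b * (truncUtil k c n w + (min (k w) n).toReal * (z - w)) := by
      rw [NNReal.smul_def, NNReal.smul_def, smul_eq_mul, smul_eq_mul]
      gcongr
    refine e.trans_eq ?_
    have : (a : ℝ) = 1 - b := by linarith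
    rw [hw', this]; ring

/-- Cutting off the gains leaves a bounded test function, so losses can be compared without any
integrability assumption. -/
theorem min_truncUtil_mem_SSD (hk : Antitone k) (c : ℝ) (n : ℕ) :
    (fun x => min (truncUtil k c n x) 0) ∈ SSD := by
  have h := truncUtil_mem_SSD hk c n
  exact ⟨fun x y hxy => min_le_min_right _ (h.1 hxy),
    h.2.inf (concaveOn_const 0 convex_univ)⟩

theorem ofReal_intervalIntegral_trunc (hk : Antitone k) (n : ℕ) {a b : ℝ} (hab : a ≤ b) :
    ENNReal.ofReal (∫ y in a..b, (min (k y) n).toReal)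
      = ∫⁻ y in Set.Icc a b, min (k y) n := by
  have hii := (antitone_trunc hk n).intervalIntegrable (a := a) (b := b) (μ := volume)
  rw [intervalIntegral.integral_of_le hab, ofReal_integral_eq_lintegral_ofReal
    ((intervalIntegrable_iff_integrableOn_Ioc_of_le hab).1 hii)
    (Filter.Eventually.of_forall fun _ => ENNReal.toReal_nonneg),
    setLIntegral_congr Ioc_ae_eq_Icc]
  exact lintegral_congr fun y => ENNReal.ofReal_toReal
    (ne_top_of_le_ne_top (by finiteness) (min_le_right _ _))

theorem ofReal_truncUtil (hk : Antitone k) (c : ℝ) (n : ℕ) (x : ℝ≥0) :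
    ENNReal.ofReal (truncUtil k c n x) = ∫⁻ y in Set.Icc c x, min (k y) n := by
  rcases le_total c x with h | h
  · exact ofReal_intervalIntegral_trunc hk n h
  · rw [setLIntegral_Icc_of_le _ h, ENNReal.ofReal_eq_zero, truncUtil,
      intervalIntegral.integral_symm, neg_nonpos]
    exact intervalIntegral.integral_nonneg h fun _ _ => ENNReal.toReal_nonneg

theorem ofReal_neg_truncUtil (hk : Antitone k) (c : ℝ) (n : ℕ) (x : ℝ≥0) :
    ENNReal.ofReal (-truncUtil k c n x) = ∫⁻ y in Set.Icc (x : ℝ) c, min (k y) n := by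
  rcases le_total c x with h | h
  · rw [setLIntegral_Icc_of_le _ h, ENNReal.ofReal_eq_zero, neg_nonpos]
    exact intervalIntegral.integral_nonneg h fun _ _ => ENNReal.toReal_nonneg
  · rw [truncUtil, ← intervalIntegral.integral_symm]
    exact ofReal_intervalIntegral_trunc hk n h

end Concave

namespace Market

variable {Ω : Type*} [MeasurableSpace Ω] {M : Market Ω}

/-! ### Payoffs and prices -/

/-- The σ-algebra is generated by the asset, so every measurable function factors through it
(Doob-Dynkin); rearrangements are thus genuine payoffs. -/
theorem mem_payoffs_iff {X : Ω → ℝ≥0} :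
    X ∈ M.payoffs ↔ Measurable X ∧ ∫⁻ ω, X ω ∂M.Q ≠ ⊤ := by
  have hS : Measurable M.S := measurable_iff_comap_le.2 M.sigma_eq.ge
  have hint : ∀ {X : Ω → ℝ≥0}, Measurable X →
      (Integrable (fun ω => (X ω : ℝ)) M.Q ↔ ∫⁻ ω, X ω ∂M.Q ≠ ⊤) := by
    intro X hX
    have : (∫⁻ ω, ‖(X ω : ℝ)‖ₑ ∂M.Q) = ∫⁻ ω, X ω ∂M.Q := by simp
    rw [Integrable, hasFiniteIntegral_iff_enorm, this, lt_top_iff_ne_top]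
    exact and_iff_right (by fun_prop)
  constructor
  · rintro ⟨⟨g, hg, rfl⟩, h⟩
    exact ⟨hg.comp hS, (hint (hg.comp hS)).1 h⟩
  · rintro ⟨hX, h⟩
    have hX' : Measurable[MeasurableSpace.comap M.S inferInstance] X :=
      hX.mono M.sigma_eq.le le_rfl
    obtain ⟨g, hg, rfl⟩ := hX'.exists_eq_measurable_comp
    exact ⟨⟨g, hg, rfl⟩, (hint hX).2 h⟩

theorem integral_eq_toReal {X : Ω → ℝ≥0} (hX : X ∈ M.payoffs) :
    ∫ ω, (X ω : ℝ) ∂M.Q = (∫⁻ ω, X ω ∂M.Q).toReal := by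
  have hm := (mem_payoffs_iff.1 hX).1
  rw [integral_eq_lintegral_of_nonneg_ae (f := fun ω => (X ω : ℝ))
    (Filter.Eventually.of_forall fun ω => (X ω).2)
    (by fun_prop)]
  simp

theorem integral_le_iff {X Y : Ω → ℝ≥0} (hX : X ∈ M.payoffs) (hY : Y ∈ M.payoffs) :
    ∫ ω, (X ω : ℝ) ∂M.Q ≤ ∫ ω, (Y ω : ℝ) ∂M.Q ↔ ∫⁻ ω, X ω ∂M.Q ≤ ∫⁻ ω, Y ω ∂M.Q := by
  rw [integral_eq_toReal hX, integral_eq_toReal hY,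
    ENNReal.toReal_le_toReal (mem_payoffs_iff.1 hX).2 (mem_payoffs_iff.1 hY).2]

theorem price_le_iff {X Y : Ω → ℝ≥0} (hX : X ∈ M.payoffs) (hY : Y ∈ M.payoffs) :
    M.price X ≤ M.price Y ↔ ∫⁻ ω, X ω ∂M.Q ≤ ∫⁻ ω, Y ω ∂M.Q := by
  rw [price, price, mul_le_mul_iff_right₀ (Real.exp_pos _), integral_le_iff hX hY]

/-! ### Likelihood ratios and state prices -/

theorem measurable_lik (P : Measure Ω) : Measurable (M.lik P) :=
  ENNReal.measurable_toNNReal.comp (Measure.measurable_rnDeriv _ _)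

theorem measurable_statePrice (P : Measure Ω) : Measurable (M.statePrice P) :=
  measurable_const.div (measurable_lik P)

theorem coe_lik_ae {P : Measure Ω} (hP : P ∈ M.models) :
    ∀ᵐ ω ∂M.Q, (M.lik P ω : ℝ≥0∞) = P.rnDeriv M.Q ω := by
  have := M.isProb P hP
  have := M.isProb_Q
  filter_upwards [P.rnDeriv_lt_top M.Q] with ω hω
  exact ENNReal.coe_toNNReal hω.ne

theorem lintegral_eq_lintegral_lik {P : Measure Ω} (hP : P ∈ M.models) {f : Ω → ℝ≥0∞}
    (hf : Measurable f) : ∫⁻ ω, f ω ∂P = ∫⁻ ω, M.lik P ω * f ω ∂M.Q := by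
  have := M.isProb P hP
  have := M.isProb_Q
  rw [← lintegral_rnDeriv_mul (M.equiv P hP).1 hf.aemeasurable]
  refine lintegral_congr_ae ?_
  filter_upwards [coe_lik_ae hP] with ω hω
  rw [hω]

theorem measure_eq_setLIntegral_lik {P : Measure Ω} (hP : P ∈ M.models) (s : Set Ω)
    (hs : MeasurableSet s) : P s = ∫⁻ ω in s, M.lik P ω ∂M.Q := by
  rw [← lintegral_indicator_one hs, lintegral_eq_lintegral_lik hP (measurable_one.indicator hs),
    ← lintegral_indicator hs]
  refine lintegral_congr fun ω => ?_
  by_cases h : ω ∈ s <;> simp [h]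

theorem lik_pos {P : Measure Ω} (hP : P ∈ M.models) : ∀ᵐ ω ∂P, 0 < M.lik P ω := by
  have := M.isProb P hP
  have := M.isProb_Q
  filter_upwards [Measure.rnDeriv_pos (M.equiv P hP).1,
    (M.equiv P hP).1.ae_le (coe_lik_ae hP)] with ω h1 h2
  rw [← h2] at h1
  exact_mod_cast h1

/-- The likelihood ratio cancels against its reciprocal; this turns the budget constraint into an
expectation under `P`. -/
theorem lintegral_statePrice_mul {P : Measure Ω} (hP : P ∈ M.models) {X : Ω → ℝ≥0}
    (hX : Measurable X) : ∫⁻ ω, (M.statePrice P ω : ℝ≥0∞) * X ω ∂P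
      = ENNReal.ofReal (Real.exp (-(M.r * M.T))) * ∫⁻ ω, X ω ∂M.Q := by
  have hm := measurable_statePrice (M := M) P
  rw [lintegral_eq_lintegral_lik hP (by fun_prop), ← lintegral_const_mul _ (by fun_prop)]
  refine lintegral_congr_ae ?_
  filter_upwards [(M.equiv P hP).2.ae_le (lik_pos hP)] with ω hω
  have : M.lik P ω * (M.statePrice P ω * X ω)
      = (Real.exp (-(M.r * M.T))).toNNReal * X ω := by
    rw [statePrice]; field_simp
  rw [ENNReal.ofReal]
  exact_mod_cast this

theorem statePrice_pos {P : Measure Ω} (hP : P ∈ M.models) :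
    ∀ᵐ ω ∂P, 0 < M.statePrice P ω := by
  filter_upwards [lik_pos hP] with ω hω
  exact div_pos (Real.toNNReal_pos.2 (Real.exp_pos _)) hω

theorem measure_statePrice_eq {P : Measure Ω} (hP : P ∈ M.models)
    (hreg : M.RegularLikelihood P) (s : ℝ≥0) : P {ω | M.statePrice P ω = s} = 0 := by
  have := M.isProb P hP
  rw [measure_eq_zero_iff_ae_notMem]
  have hd : 0 < (Real.exp (-(M.r * M.T))).toNNReal := Real.toNNReal_pos.2 (Real.exp_pos _)
  filter_upwards [lik_pos hP, measure_eq_zero_iff_ae_notMem.1 (measure_eq_const_eq_zero P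
    (measurable_lik P) hreg.1 ((Real.exp (-(M.r * M.T))).toNNReal / s))] with ω h1 h2 h3
  refine h2 ?_
  simp only [statePrice] at h3 ⊢
  rw [← h3]; field_simp

/-- The state price is decreasing in the likelihood ratio, and without atoms the difference between
strict and weak inequality is null. -/
theorem distFun_statePrice {P : Measure Ω} (hP : P ∈ M.models) (hreg : M.RegularLikelihood P) :
    ∀ᵐ ω ∂P, distFun (law P (M.statePrice P)) (M.statePrice P ω)
      = 1 - distFun (law P (M.lik P)) (M.lik P ω) := by
  have := M.isProb P hP
  have hd : 0 < (Real.exp (-(M.r * M.T))).toNNReal := Real.toNNReal_pos.2 (Real.exp_pos _)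
  filter_upwards [lik_pos hP] with ω hω
  rw [distFun_law P (measurable_statePrice P), ← measureReal_lt_eq_one_sub_distFun P
    (measurable_lik P)]
  refine measureReal_congr ?_
  filter_upwards [lik_pos hP, measure_eq_zero_iff_ae_notMem.1 (measure_eq_const_eq_zero P
    (measurable_lik P) hreg.1 (M.lik P ω))] with ω' h1 h2
  refine propext ?_
  change (M.statePrice P ω' : ℝ) ≤ M.statePrice P ω ↔ (M.lik P ω : ℝ) < M.lik P ω'
  rw [NNReal.coe_le_coe, NNReal.coe_lt_coe, statePrice, statePrice,
    div_le_div_iff_of_pos_left hd h1 hω]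
  exact ⟨fun h => lt_of_le_of_ne h fun e => h2 e.symm, le_of_lt⟩

/-! ### Cost-efficient payoffs -/

theorem lintegral_le_of_nondecreasingInLik {P : Measure Ω} (hP : P ∈ M.models)
    (hreg : M.RegularLikelihood P) {X Y : Ω → ℝ≥0} (hX : Measurable X) (hY : Measurable Y)
    (hmono : M.NondecreasingInLik P Y) (hlaw : law P X = law P Y) :
    ∫⁻ ω, Y ω ∂M.Q ≤ ∫⁻ ω, X ω ∂M.Q ∧
      (∫⁻ ω, Y ω ∂M.Q ≠ ⊤ → ∫⁻ ω, X ω ∂M.Q ≤ ∫⁻ ω, Y ω ∂M.Q → X =ᵐ[P] Y) := by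
  have := M.isProb P hP
  have := M.isProb_Q
  exact lintegral_le_of_nondecreasing (measure_eq_setLIntegral_lik hP) (M.equiv P hP).2
    (M.equiv P hP).1 (measure_eq_const_eq_zero P (measurable_lik P) hreg.1) hX hY hmono
    fun t => (measure_lt_eq_of_law_eq hX hY hlaw t).ge

/-- The payoff with the same distribution as `X` under `P` that is nondecreasing in the
likelihood ratio. -/
noncomputable def efficient (M : Market Ω) (P : Measure Ω) (X : Ω → ℝ≥0) : Ω → ℝ≥0 :=
  rearrangement P (M.lik P) X

theorem measurable_efficient (P : Measure Ω) (X : Ω → ℝ≥0) : Measurable (M.efficient P X) :=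
  measurable_rearrangement P (measurable_lik P) X

theorem efficient_nondecreasing {P : Measure Ω} (hP : P ∈ M.models)
    (hreg : M.RegularLikelihood P) (X : Ω → ℝ≥0) :
    M.NondecreasingInLik P (M.efficient P X) :=
  have := M.isProb P hP
  rearrangement_nondecreasing P (measurable_lik P) hreg.1 X

theorem law_efficient {P : Measure Ω} (hP : P ∈ M.models) (hreg : M.RegularLikelihood P)
    {X : Ω → ℝ≥0} (hX : Measurable X) : law P (M.efficient P X) = law P X :=
  have := M.isProb P hP
  law_rearrangement P (measurable_lik P) hreg.1 hX

theorem coe_efficient {P : Measure Ω} (hP : P ∈ M.models) (hreg : M.RegularLikelihood P)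
    (X : Ω → ℝ≥0) : ∀ᵐ ω ∂P, (M.efficient P X ω : ℝ≥0∞)
      = quantile (law P X) (distFun (law P (M.lik P)) (M.lik P ω)) :=
  have := M.isProb P hP
  coe_rearrangement P (measurable_lik P) hreg.1 X

theorem lintegral_efficient_le {P : Measure Ω} (hP : P ∈ M.models)
    (hreg : M.RegularLikelihood P) {X : Ω → ℝ≥0} (hX : Measurable X) :
    ∫⁻ ω, M.efficient P X ω ∂M.Q ≤ ∫⁻ ω, X ω ∂M.Q :=
  (lintegral_le_of_nondecreasingInLik hP hreg hX (measurable_efficient P X)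
    (efficient_nondecreasing hP hreg X) (law_efficient hP hreg hX).symm).1

theorem efficient_mem_payoffs {P : Measure Ω} (hP : P ∈ M.models)
    (hreg : M.RegularLikelihood P) {X : Ω → ℝ≥0} (hX : X ∈ M.payoffs) :
    M.efficient P X ∈ M.payoffs := by
  rw [mem_payoffs_iff] at hX ⊢
  exact ⟨measurable_efficient P X,
    ne_top_of_le_ne_top hX.2 (lintegral_efficient_le hP hreg hX.1)⟩

theorem ae_eq_efficient {P : Measure Ω} (hP : P ∈ M.models)
    (hreg : M.RegularLikelihood P) {X : Ω → ℝ≥0} (hX : X ∈ M.payoffs)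
    (hle : ∫⁻ ω, X ω ∂M.Q ≤ ∫⁻ ω, M.efficient P X ω ∂M.Q) : X =ᵐ[P] M.efficient P X := by
  have hm := (mem_payoffs_iff.1 hX).1
  exact (lintegral_le_of_nondecreasingInLik hP hreg hm (measurable_efficient P X)
    (efficient_nondecreasing hP hreg X) (law_efficient hP hreg hm).symm).2
    (mem_payoffs_iff.1 (efficient_mem_payoffs hP hreg hX)).2 hle

theorem costEfficient_of_nondecreasing {P : Measure Ω} (hP : P ∈ M.models)
    (hreg : M.RegularLikelihood P) {X : Ω → ℝ≥0} (hX : X ∈ M.payoffs)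
    (hmono : M.NondecreasingInLik P X) : M.CostEfficient P X := by
  refine ⟨⟨hX, rfl⟩, fun Y hY => ?_⟩
  rw [price_le_iff hX hY.1]
  exact (lintegral_le_of_nondecreasingInLik hP hreg (mem_payoffs_iff.1 hY.1).1
    (mem_payoffs_iff.1 hX).1 hmono hY.2).1

theorem ae_eq_efficient_of_costEfficient {P : Measure Ω} (hP : P ∈ M.models)
    (hreg : M.RegularLikelihood P) {X : Ω → ℝ≥0} (h : M.CostEfficient P X) :
    X =ᵐ[P] M.efficient P X := by
  have hX := h.1.1
  have hE := efficient_mem_payoffs hP hreg hX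
  exact ae_eq_efficient hP hreg hX ((price_le_iff hX hE).1
    (h.2 _ ⟨hE, law_efficient hP hreg (mem_payoffs_iff.1 hX).1⟩))

theorem nondecreasing_of_ae_eq_efficient {P : Measure Ω} (hP : P ∈ M.models)
    (hreg : M.RegularLikelihood P) {X : Ω → ℝ≥0} (h : X =ᵐ[P] M.efficient P X) :
    M.NondecreasingInLik P X := by
  obtain ⟨A, hA, hA'⟩ := efficient_nondecreasing hP hreg X
  refine ⟨A ∩ {ω | X ω = M.efficient P X ω}, hA.and h, fun ω hω ω' hω' hle => ?_⟩
  rw [show X ω = _ from hω.2, show X ω' = _ from hω'.2]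
  exact hA' ω hω.1 ω' hω'.1 hle

theorem quantile_iff_ae_eq_efficient {P : Measure Ω} (hP : P ∈ M.models)
    (hreg : M.RegularLikelihood P) {X : Ω → ℝ≥0} :
    (∀ᵐ ω ∂P, (X ω : ℝ≥0∞) = quantile (law P X) (distFun (law P (M.lik P)) (M.lik P ω))) ↔
      X =ᵐ[P] M.efficient P X := by
  have h := coe_efficient hP hreg X
  constructor
  · intro h'
    filter_upwards [h, h'] with ω h1 h2
    rw [← h1] at h2
    exact_mod_cast h2
  · intro h'
    filter_upwards [h, h'] with ω h1 h2
    rw [h2, h1]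

/-! ### Robust cost-efficiency -/

theorem law_congr {P : Measure Ω} {X Y : Ω → ℝ≥0} (h : X =ᵐ[P] Y) : law P X = law P Y :=
  Measure.map_congr h

/-- The efficient payoff dominates its distribution under the least favorable measure. -/
theorem integralOrder_efficient {𝔽 : Set (ℝ≥0 → ℝ)} (hFSD : 𝔽 ⊆ FSD)
    (hcomp : CompositionConsistent 𝔽) {P : Measure Ω} (hP : M.LeastFavorable 𝔽 P)
    (hreg : M.RegularLikelihood P) {X : Ω → ℝ≥0} (hab : 𝔽 = FSD ∨ M.Compatible 𝔽 P X)
    {P' : Measure Ω} (hP' : P' ∈ M.models) :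
    IntegralOrder 𝔽 (law P (M.efficient P X)) (law P' (M.efficient P X)) := by
  have := M.isProb P hP.1
  have := M.isProb P' hP'
  have hac : P' ≪ P := (M.equiv P' hP').1.trans (M.equiv P hP.1).2
  rcases hab with rfl | ⟨-, g, hg, hgq⟩
  · exact integralOrder_FSD_of_nondecreasing hac (measurable_lik P) (measurable_efficient P X)
      (efficient_nondecreasing hP.1 hreg X) (hP.2 P' hP')
  -- The extension `g` agrees a.s. with the quantile composition, since the levels lie in the open
  -- unit interval. Testing with `f` then means testing the likelihood ratio with `f ∘ g`, which
  -- composition-consistency allows.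
  · have hgm : Measurable g := by
      have : Monotone g := fun x y hxy => by exact_mod_cast hFSD hg hxy
      exact this.measurable
    have hE : M.efficient P X =ᵐ[P] fun ω => g (M.lik P ω) := by
      filter_upwards [ae_distFun_mem_Ioo P (measurable_lik P) hreg.1,
        coe_efficient hP.1 hreg X] with ω h1 h2
      rw [← hgq _ h1.1 h1.2] at h2
      exact_mod_cast h2
    rw [law_congr hE, law_congr (hac.ae_le hE)]
    have hlaw : ∀ ν : Measure Ω, law ν (fun ω => g (M.lik P ω)) = (law ν (M.lik P)).map g :=
      fun ν => (Measure.map_map hgm (measurable_lik P)).symm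
    intro f hf hi hi'
    have hfm : Measurable f := Monotone.measurable (hFSD hf)
    rw [hlaw] at hi hi' ⊢
    rw [hlaw, integral_map hgm.aemeasurable hfm.aestronglyMeasurable,
      integral_map hgm.aemeasurable hfm.aestronglyMeasurable]
    exact hP.2 P' hP' _ (hcomp f hf g hg)
      ((integrable_map_measure hfm.aestronglyMeasurable hgm.aemeasurable).1 hi)
      ((integrable_map_measure hfm.aestronglyMeasurable hgm.aemeasurable).1 hi')

theorem integralOrder_congr_efficient {𝔽 : Set (ℝ≥0 → ℝ)} (hFSD : 𝔽 ⊆ FSD)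
    (hcomp : CompositionConsistent 𝔽) {P : Measure Ω} (hP : M.LeastFavorable 𝔽 P)
    (hreg : M.RegularLikelihood P) {X : Ω → ℝ≥0} (hab : 𝔽 = FSD ∨ M.Compatible 𝔽 P X)
    (hX : X =ᵐ[P] M.efficient P X) {P' : Measure Ω} (hP' : P' ∈ M.models) :
    IntegralOrder 𝔽 (law P X) (law P' X) := by
  have hac : P' ≪ P := (M.equiv P' hP').1.trans (M.equiv P hP.1).2
  rw [law_congr hX, law_congr (hac.ae_le hX)]
  exact integralOrder_efficient hFSD hcomp hP hreg hab hP'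

/-- The rearrangement of `X` is robustly admissible and no dearer than `X`, so a robust optimum must
coincide with it. Conversely, each competitor is replaced by its own cheaper rearrangement under
`P`; both payoffs are then cost-efficient and cost-consistency compares them. -/
theorem robustCostEfficient_iff {𝔽 : Set (ℝ≥0 → ℝ)} (hFSD : 𝔽 ⊆ FSD)
    (hcomp : CompositionConsistent 𝔽) (hcost : M.CostConsistent 𝔽) {P : Measure Ω}
    (hP : M.LeastFavorable 𝔽 P) (hreg : M.RegularLikelihood P) {X : Ω → ℝ≥0}
    (hX : X ∈ M.payoffs) (hab : 𝔽 = FSD ∨ M.Compatible 𝔽 P X) :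
    M.RobustCostEfficient 𝔽 (law P X) X ↔ M.CostEfficient P X := by
  have hm := (mem_payoffs_iff.1 hX).1
  have hE := efficient_mem_payoffs hP.1 hreg hX
  constructor
  · intro h
    have hadm : M.efficient P X ∈ M.robustAdmissible 𝔽 (law P X) := by
      refine ⟨hE, fun P' hP' => ?_⟩
      rw [← law_efficient hP.1 hreg hm]
      exact integralOrder_efficient hFSD hcomp hP hreg hab hP'
    refine costEfficient_of_nondecreasing hP.1 hreg hX
      (nondecreasing_of_ae_eq_efficient hP.1 hreg (ae_eq_efficient hP.1 hreg hX ?_))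
    exact (price_le_iff hX hE).1 (h.2 _ hadm)
  · intro h
    have hXE := ae_eq_efficient_of_costEfficient hP.1 hreg h
    refine ⟨⟨hX, fun P' hP' => integralOrder_congr_efficient hFSD hcomp hP hreg hab hXE hP'⟩,
      fun Y hY => ?_⟩
    have hYm := (mem_payoffs_iff.1 hY.1).1
    have hYE := efficient_mem_payoffs hP.1 hreg hY.1
    have hle := (hcost X hX _ hYE P hP.1 h
      (costEfficient_of_nondecreasing hP.1 hreg hYE (efficient_nondecreasing hP.1 hreg Y))
      (by rw [law_efficient hP.1 hreg hYm]; exact hY.2 P hP.1)).1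
    rw [price_le_iff hX hY.1]
    exact ((integral_le_iff hX hYE).1 hle).trans (lintegral_efficient_le hP.1 hreg hYm)

end Market

/-! ### Differences of extended nonnegative numbers -/

section EReal

theorem ereal_sub_ne {a b : ℝ≥0∞} :
    ((a : EReal) - b ≠ ⊥ ∧ (a : EReal) - b ≠ ⊤) ↔ (a ≠ ⊤ ∧ b ≠ ⊤) := by
  induction b with
  | top => simp
  | coe b =>
    induction a with
    | top =>
      have : (⊤ : EReal) - ((b : ℝ≥0∞) : EReal) = ⊤ := by
        rw [EReal.coe_nnreal_eq_coe_real]; exact EReal.top_sub_coe _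
      simp [this]
    | coe a =>
      have : (((a : ℝ≥0∞) : EReal) - ((b : ℝ≥0∞) : EReal)) = (((a : ℝ) - b : ℝ) : EReal) := by
        rw [EReal.coe_nnreal_eq_coe_real, EReal.coe_nnreal_eq_coe_real]; norm_cast
      rw [this]
      simp [-EReal.coe_sub]

theorem ereal_top_sub {b : ℝ≥0∞} (hb : b ≠ ⊤) : ((⊤ : ℝ≥0∞) : EReal) - b = ⊤ := by
  lift b to ℝ≥0 using hb
  rw [EReal.coe_nnreal_eq_coe_real]; exact EReal.top_sub_coe _

theorem ereal_sub_top (a : ℝ≥0∞) : (a : EReal) - ((⊤ : ℝ≥0∞) : EReal) = ⊥ := by simp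

theorem ereal_sub_le_sub_iff {a b a' b' : ℝ≥0∞} (ha : a ≠ ⊤) (hb : b ≠ ⊤) (ha' : a' ≠ ⊤)
    (hb' : b' ≠ ⊤) : (a : EReal) - b ≤ a' - b' ↔ a + b' ≤ a' + b := by
  lift a to ℝ≥0 using ha
  lift b to ℝ≥0 using hb
  lift a' to ℝ≥0 using ha'
  lift b' to ℝ≥0 using hb'
  have h : ∀ x y : ℝ≥0, (((x : ℝ≥0∞) : EReal) - ((y : ℝ≥0∞) : EReal))
      = (((x : ℝ) - y : ℝ) : EReal) := by
    intro x y
    rw [EReal.coe_nnreal_eq_coe_real, EReal.coe_nnreal_eq_coe_real]; norm_cast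
  rw [h, h, EReal.coe_le_coe_iff, sub_le_sub_iff]
  norm_cast

end EReal

/-! ### Expected utilities under an integral order -/

section UtilityOrder

variable {Ω : Type*} [MeasurableSpace Ω] {k : ℝ → ℝ≥0∞}

/-- The positive part of the utility function `x ↦ ∫_c^x k`. -/
noncomputable def gain (k : ℝ → ℝ≥0∞) (c x : ℝ≥0) : ℝ≥0∞ := ∫⁻ y in Set.Icc (c : ℝ) x, k y

/-- The negative part of the utility function `x ↦ ∫_c^x k`. -/
noncomputable def loss (k : ℝ → ℝ≥0∞) (c x : ℝ≥0) : ℝ≥0∞ := ∫⁻ y in Set.Icc (x : ℝ) c, k y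

theorem gain_mono (k : ℝ → ℝ≥0∞) (c : ℝ≥0) : Monotone (gain k c) :=
  fun _ _ h => lintegral_mono_set (Set.Icc_subset_Icc_right (NNReal.coe_le_coe.2 h))

theorem loss_anti (k : ℝ → ℝ≥0∞) (c : ℝ≥0) : Antitone (loss k c) :=
  fun _ _ h => lintegral_mono_set (Set.Icc_subset_Icc_left (NNReal.coe_le_coe.2 h))

theorem measurable_gain (k : ℝ → ℝ≥0∞) (c : ℝ≥0) : Measurable (gain k c) :=
  (gain_mono k c).measurable

theorem measurable_loss (k : ℝ → ℝ≥0∞) (c : ℝ≥0) : Measurable (loss k c) :=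
  (loss_anti k c).measurable

theorem gain_eq_zero (k : ℝ → ℝ≥0∞) {c x : ℝ≥0} (h : x ≤ c) : gain k c x = 0 :=
  setLIntegral_Icc_of_le k (NNReal.coe_le_coe.2 h)

theorem loss_eq_zero (k : ℝ → ℝ≥0∞) {c x : ℝ≥0} (h : c ≤ x) : loss k c x = 0 :=
  setLIntegral_Icc_of_le k (NNReal.coe_le_coe.2 h)

theorem gain_ne_top (hk : Antitone k) {c : ℝ≥0} (hc : k c ≠ ⊤) (x : ℝ≥0) : gain k c x ≠ ⊤ :=
  ne_top_of_le_ne_top (ENNReal.mul_ne_top hc ENNReal.ofReal_ne_top)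
    (setLIntegral_Icc_le_mul fun _ hy => hk hy)

theorem loss_trunc_mono (k : ℝ → ℝ≥0∞) (c x : ℝ≥0) :
    Monotone fun n : ℕ => loss (fun y => min (k y) n) c x :=
  fun _ _ hmn => lintegral_mono fun _ => min_le_min_left _ (by exact_mod_cast hmn)

/-- The utility can be `-∞` to the left of `c` and is then no real test function; capping its slope
makes it one, and monotone convergence recovers the losses. -/
theorem loss_eq_iSup (hk : Antitone k) (c x : ℝ≥0) :
    loss k c x = ⨆ n : ℕ, loss (fun y => min (k y) n) c x := by
  simp only [loss]
  rw [← lintegral_iSup (fun n => (hk.measurable.min measurable_const))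
    (fun m n hmn y => min_le_min_left _ (by exact_mod_cast hmn))]
  refine lintegral_congr fun y => ?_
  rw [← inf_iSup_eq, ENNReal.iSup_natCast, inf_top_eq]

theorem lintegral_loss_eq_iSup (hk : Antitone k) (c : ℝ≥0) (P : Measure Ω) {Y : Ω → ℝ≥0}
    (hY : Measurable Y) : ∫⁻ ω, loss k c (Y ω) ∂P
      = ⨆ n : ℕ, ∫⁻ ω, loss (fun y => min (k y) n) c (Y ω) ∂P := by
  rw [← lintegral_iSup (f := fun (n : ℕ) ω => loss (fun y => min (k y) n) c (Y ω))
    (fun n => (measurable_loss _ c).comp hY) (fun m n hmn ω => loss_trunc_mono k c _ hmn)]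
  exact lintegral_congr fun ω => loss_eq_iSup hk c _

/-- To the right of `c` the slope never exceeds `k c`, so a high enough cap affects losses only. -/
theorem gain_trunc_eq (hk : Antitone k) {c : ℝ≥0} {n : ℕ} (hn : k c ≤ n) (x : ℝ≥0) :
    gain (fun y => min (k y) n) c x = gain k c x :=
  setLIntegral_congr_fun measurableSet_Icc fun _ hy => min_eq_left ((hk hy.1).trans hn)

variable {𝔽 : Set (ℝ≥0 → ℝ)} {P P' : Measure Ω} {Y : Ω → ℝ≥0}

theorem measurable_truncUtil (hk : Antitone k) (c : ℝ) (n : ℕ) : Measurable (truncUtil k c n) :=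
  (truncUtil_mem_SSD hk c n).1.measurable

theorem lintegral_truncLoss_ne_top [IsProbabilityMeasure P] (c : ℝ≥0) (n : ℕ) :
    ∫⁻ ω, loss (fun y => min (k y) n) c (Y ω) ∂P ≠ ⊤ := by
  have hb : ∀ ω, loss (fun y => min (k y) n) c (Y ω) ≤ n * c := by
    intro ω
    refine (setLIntegral_Icc_le_mul (s := n) fun y _ => min_le_right _ _).trans ?_
    gcongr
    rw [← ENNReal.ofReal_coe_nnreal]
    exact ENNReal.ofReal_le_ofReal (by linarith [(Y ω).2])
  refine ne_top_of_le_ne_top ?_ (lintegral_mono hb)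
  rw [lintegral_const, measure_univ]
  finiteness

theorem integral_le_integral_of_integralOrder (h : IntegralOrder 𝔽 (law P Y) (law P' Y))
    (hY : Measurable Y) {f : ℝ≥0 → ℝ} (hf : f ∈ 𝔽) (hfm : Measurable f)
    (hi : Integrable (fun ω => f (Y ω)) P) (hi' : Integrable (fun ω => f (Y ω)) P') :
    ∫ ω, f (Y ω) ∂P ≤ ∫ ω, f (Y ω) ∂P' := by
  have hle := h f hf
    ((integrable_map_measure hfm.aestronglyMeasurable hY.aemeasurable).2 hi)
    ((integrable_map_measure hfm.aestronglyMeasurable hY.aemeasurable).2 hi')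
  rwa [law, law, integral_map hY.aemeasurable hfm.aestronglyMeasurable,
    integral_map hY.aemeasurable hfm.aestronglyMeasurable] at hle

/-- Expected losses are smaller under dominating distributions. -/
theorem lintegral_loss_le [IsProbabilityMeasure P] [IsProbabilityMeasure P'] (hk : Antitone k)
    (c : ℝ≥0) (hSSD : SSD ⊆ 𝔽) (hY : Measurable Y)
    (h : IntegralOrder 𝔽 (law P Y) (law P' Y)) :
    ∫⁻ ω, loss k c (Y ω) ∂P' ≤ ∫⁻ ω, loss k c (Y ω) ∂P := by
  rw [lintegral_loss_eq_iSup hk c P hY, lintegral_loss_eq_iSup hk c P' hY]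
  refine iSup_mono fun n => ?_
  set f : ℝ≥0 → ℝ := fun x => min (truncUtil k c n x) 0 with hf
  have hfm : Measurable f := (measurable_truncUtil hk c n).min measurable_const
  have hval : ∀ x : ℝ≥0, ENNReal.ofReal (-f x) = loss (fun y => min (k y) n) c x := by
    intro x
    rw [loss, ← ofReal_neg_truncUtil hk, hf, ← max_neg_neg]
    simp [ENNReal.ofReal_max]
  have hfn : ∀ x, 0 ≤ -f x := fun x => by simp [hf]
  have hint : ∀ ν : Measure Ω, IsProbabilityMeasure ν → Integrable (fun ω => f (Y ω)) ν := by
    intro ν _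
    refine ⟨(hfm.comp hY).aestronglyMeasurable, ?_⟩
    rw [hasFiniteIntegral_iff_enorm, lt_top_iff_ne_top]
    simp_rw [← enorm_neg (f _), Real.enorm_eq_ofReal (hfn _), hval]
    exact lintegral_truncLoss_ne_top c n
  have hle := integral_le_integral_of_integralOrder h hY (hSSD (min_truncUtil_mem_SSD hk c n)) hfm
    (hint P inferInstance) (hint P' inferInstance)
  have hof : ∀ ν : Measure Ω, IsProbabilityMeasure ν →
      ∫⁻ ω, loss (fun y => min (k y) n) c (Y ω) ∂ν = ENNReal.ofReal (-∫ ω, f (Y ω) ∂ν) := by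
    intro ν hν
    rw [← integral_neg, ofReal_integral_eq_lintegral_ofReal (f := fun ω => -f (Y ω)) (hint ν hν).neg
      (Filter.Eventually.of_forall fun ω => hfn (Y ω))]
    simp_rw [hval]
  rw [hof P inferInstance, hof P' inferInstance]
  exact ENNReal.ofReal_le_ofReal (neg_le_neg hle)

/-- The inequality of expected utilities without subtraction. It holds for capped slopes; the cap is
harmless on the right, and the supremum over caps restores the loss on the left. -/
theorem lintegral_gain_add_loss_le [IsProbabilityMeasure P] [IsProbabilityMeasure P']
    (hk : Antitone k) (c : ℝ≥0) (hc : k c ≠ ⊤) (hSSD : SSD ⊆ 𝔽) (hY : Measurable Y)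
    (h : IntegralOrder 𝔽 (law P Y) (law P' Y))
    (hP : ∫⁻ ω, gain k c (Y ω) ∂P ≠ ⊤) (hP' : ∫⁻ ω, gain k c (Y ω) ∂P' ≠ ⊤) :
    ∫⁻ ω, gain k c (Y ω) ∂P + ∫⁻ ω, loss k c (Y ω) ∂P'
      ≤ ∫⁻ ω, gain k c (Y ω) ∂P' + ∫⁻ ω, loss k c (Y ω) ∂P := by
  obtain ⟨m, hm⟩ := ENNReal.exists_nat_gt hc
  have key : ∀ n : ℕ, m ≤ n →
      ∫⁻ ω, gain k c (Y ω) ∂P + ∫⁻ ω, loss (fun y => min (k y) n) c (Y ω) ∂P'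
        ≤ ∫⁻ ω, gain k c (Y ω) ∂P' + ∫⁻ ω, loss k c (Y ω) ∂P := by
    intro n hn
    have hn' : k c ≤ n := hm.le.trans (by exact_mod_cast hn)
    have hfm := measurable_truncUtil hk c n
    have hg : ∀ x, ENNReal.ofReal (truncUtil k c n x) = gain k c x := fun x => by
      rw [ofReal_truncUtil hk, ← gain_trunc_eq hk hn', gain]
    have hl : ∀ x, ENNReal.ofReal (-truncUtil k c n x) = loss (fun y => min (k y) n) c x :=
      fun x => ofReal_neg_truncUtil hk c n x
    have hint : ∀ ν : Measure Ω, IsProbabilityMeasure ν → ∫⁻ ω, gain k c (Y ω) ∂ν ≠ ⊤ →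
        Integrable (fun ω => truncUtil k c n (Y ω)) ν := by
      intro ν _ hν
      refine ⟨(hfm.comp hY).aestronglyMeasurable, ?_⟩
      rw [hasFiniteIntegral_iff_enorm, lt_top_iff_ne_top]
      refine ne_top_of_le_ne_top (ENNReal.add_ne_top.2 ⟨hν,
          lintegral_truncLoss_ne_top (k := k) (Y := Y) c n⟩)
        (le_trans (lintegral_mono fun ω => ?_)
          (lintegral_add_left ((measurable_gain k c).comp hY) _).le)
      change _ ≤ gain k c (Y ω) + loss (fun y => min (k y) n) c (Y ω)
      rw [← hg, ← hl]
      rcases le_total 0 (truncUtil k c n (Y ω)) with h0 | h0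
      · rw [Real.enorm_eq_ofReal h0]; exact le_self_add
      · rw [← enorm_neg, Real.enorm_eq_ofReal (neg_nonneg.2 h0)]; exact le_add_self
    have hiP := hint P inferInstance hP
    have hiP' := hint P' inferInstance hP'
    have hle := integral_le_integral_of_integralOrder h hY (hSSD (truncUtil_mem_SSD hk c n)) hfm
      hiP hiP'
    rw [integral_eq_lintegral_pos_part_sub_lintegral_neg_part hiP,
      integral_eq_lintegral_pos_part_sub_lintegral_neg_part hiP'] at hle
    simp_rw [hg, hl] at hle
    have hL := lintegral_truncLoss_ne_top (P := P) (Y := Y) (k := k) c n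
    have hL' := lintegral_truncLoss_ne_top (P := P') (Y := Y) (k := k) c n
    rw [sub_le_sub_iff, ← ENNReal.toReal_add hP hL', ← ENNReal.toReal_add hP' hL,
      ENNReal.toReal_le_toReal (ENNReal.add_ne_top.2 ⟨hP, hL'⟩)
        (ENNReal.add_ne_top.2 ⟨hP', hL⟩)] at hle
    refine hle.trans ?_
    gcongr with ω
    exact lintegral_mono fun y => min_le_left _ _
  rw [lintegral_loss_eq_iSup hk c P' hY, ENNReal.add_iSup]
  refine iSup_le fun n => le_trans ?_ (key (max n m) (le_max_right _ _))
  gcongr with ω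
  exact loss_trunc_mono k c _ (le_max_left n m)

end UtilityOrder

theorem lintegral_comp_eq_of_law_eq {Ω : Type*} [MeasurableSpace Ω] {P : Measure Ω}
    {X Y : Ω → ℝ≥0} (hX : Measurable X) (hY : Measurable Y) (h : law P X = law P Y)
    {f : ℝ≥0 → ℝ≥0∞} (hf : Measurable f) : ∫⁻ ω, f (X ω) ∂P = ∫⁻ ω, f (Y ω) ∂P := by
  have h1 := congrArg (fun μ : Measure ℝ≥0 => ∫⁻ x, f x ∂μ) h
  simpa only [law, lintegral_map hf hX, lintegral_map hf hY] using h1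

namespace Market

variable {Ω : Type*} [MeasurableSpace Ω] {M : Market Ω}

/-! ### The utility function of a payoff -/

/-- The marginal utility `y ↦ F_ξ⁻¹(1 - F_X(y))`. -/
noncomputable def marginal (M : Market Ω) (P : Measure Ω) (X : Ω → ℝ≥0) (y : ℝ) : ℝ≥0∞ :=
  quantile (law P (M.statePrice P)) (1 - distFun (law P X) y)

theorem antitone_marginal (P : Measure Ω) (X : Ω → ℝ≥0) : Antitone (M.marginal P X) :=
  fun _ _ h => quantile_mono _ (by linarith [distFun_mono (law P X) h])

theorem marginal_ne_top {P : Measure Ω} {X : Ω → ℝ≥0} {c : ℝ≥0}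
    (hc : 0 < distFun (law P X) c) : M.marginal P X c ≠ ⊤ :=
  (quantile_lt_top _ (by linarith)).ne

/-- The state price is a.s. positive, so its quantiles at positive levels are positive. This makes
the improvement of inefficient payoffs strict. -/
theorem marginal_ne_zero {P : Measure Ω} (hP : P ∈ M.models) {X : Ω → ℝ≥0} {y : ℝ}
    (hy : distFun (law P X) y < 1) : M.marginal P X y ≠ 0 := by
  have := M.isProb P hP
  intro h0
  have h1 := (quantile_le_iff (law P (M.statePrice P)) (1 - distFun (law P X) y) 0).1
    (by exact_mod_cast h0.le)
  rw [distFun_law P (measurable_statePrice P)] at h1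
  have h2 : P.real {ω | (M.statePrice P ω : ℝ) ≤ (0 : ℝ≥0)} = 0 := by
    rw [measureReal_eq_zero_iff, measure_eq_zero_iff_ae_notMem]
    filter_upwards [statePrice_pos hP] with ω hω h
    exact hω.not_ge (by exact_mod_cast h)
  rw [h2] at h1
  linarith

theorem toENNReal_utility (P : Measure Ω) (X : Ω → ℝ≥0) (c x : ℝ≥0) :
    (M.utility P X c x).toENNReal = gain (M.marginal P X) c x := by
  rw [utility]
  split_ifs with h
  · rw [EReal.toENNReal_coe]; rfl
  · rw [gain_eq_zero _ (not_le.1 h).le, EReal.toENNReal_of_nonpos]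
    simpa using EReal.coe_ennreal_nonneg _

theorem toENNReal_neg_utility (P : Measure Ω) (X : Ω → ℝ≥0) (c x : ℝ≥0) :
    (-M.utility P X c x).toENNReal = loss (M.marginal P X) c x := by
  rw [utility]
  split_ifs with h
  · rw [loss_eq_zero _ h, EReal.toENNReal_of_nonpos]
    simpa using EReal.coe_ennreal_nonneg _
  · rw [neg_neg, EReal.toENNReal_coe]; rfl

theorem expectedUtility_eq (P : Measure Ω) (X : Ω → ℝ≥0) (c : ℝ≥0) (P' : Measure Ω)
    (Y : Ω → ℝ≥0) : expectedUtility (M.utility P X c) P' Y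
      = ((∫⁻ ω, gain (M.marginal P X) c (Y ω) ∂P' : ℝ≥0∞) : EReal)
        - ((∫⁻ ω, loss (M.marginal P X) c (Y ω) ∂P' : ℝ≥0∞) : EReal) := by
  simp only [expectedUtility, toENNReal_utility, toENNReal_neg_utility]

/-- At the efficient payoff, the state price is a supergradient of the utility function. -/
theorem statePrice_supergradient {P : Measure Ω} (hP : P ∈ M.models)
    (hreg : M.RegularLikelihood P) {X Z : Ω → ℝ≥0} (hX : Measurable X)
    (hZ : Z =ᵐ[P] M.efficient P X) :
    ∀ᵐ ω ∂P, (∀ y : ℝ, y < Z ω → (M.statePrice P ω : ℝ≥0∞) ≤ M.marginal P X y) ∧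
      (∀ y : ℝ, Z ω ≤ y → M.marginal P X y ≤ M.statePrice P ω) := by
  have := M.isProb P hP
  -- Whether `y` lies below the efficient payoff depends on comparing $F_X(y)$ with
  -- $F_\ell(\ell)=1-F_\xi(\xi)$, hence on comparing the quantile level $1-F_X(y)$ with
  -- $F_\xi(\xi)$.
  filter_upwards [hZ, lt_rearrangement_iff P (measurable_lik P) hreg.1 hX,
    distFun_statePrice hP hreg] with ω h1 h2 h3
  rw [h1]
  refine ⟨fun y hy => le_iInf₂ fun x hx => ?_, fun y hy => ?_⟩
  · have hlt := (h2 y).1 hy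
    rw [ENNReal.coe_le_coe]
    by_contra hcon
    have := distFun_mono (law P (M.statePrice P)) (NNReal.coe_le_coe.2 (not_le.1 hcon).le)
    linarith
  · have hnlt := mt (h2 y).2 (not_lt.2 hy)
    exact (quantile_le_iff _ _ _).2 (by linarith)

section Optimality

variable {P : Measure Ω} {X Z Y : Ω → ℝ≥0} (c : ℝ≥0)

theorem tangent_le_ae (hP : P ∈ M.models) (hreg : M.RegularLikelihood P) (hX : Measurable X)
    (hZ : Z =ᵐ[P] M.efficient P X) (Y : Ω → ℝ≥0) :
    ∀ᵐ ω ∂P, gain (M.marginal P X) c (Y ω)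
        + (M.statePrice P ω * Z ω + loss (M.marginal P X) c (Z ω))
      ≤ gain (M.marginal P X) c (Z ω)
        + (M.statePrice P ω * Y ω + loss (M.marginal P X) c (Y ω)) := by
  filter_upwards [statePrice_supergradient hP hreg hX hZ] with ω hω
  exact tangent_le c hω.1 hω.2

/-- Comparing the efficient payoff with the constant `c` in the tangent inequality bounds its loss
by $\xi c$, which is integrable; losses depend on the law only. -/
theorem lintegral_loss_ne_top (hP : P ∈ M.models) (hreg : M.RegularLikelihood P)
    (hX : Measurable X) : ∫⁻ ω, loss (M.marginal P X) c (X ω) ∂P ≠ ⊤ := by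
  have := M.isProb_Q
  rw [lintegral_comp_eq_of_law_eq hX (measurable_efficient P X) (law_efficient hP hreg hX).symm
    (measurable_loss _ c)]
  have hle : ∀ᵐ ω ∂P, loss (M.marginal P X) c (M.efficient P X ω)
      ≤ (M.statePrice P ω : ℝ≥0∞) * c := by
    filter_upwards [tangent_le_ae c hP hreg hX (Filter.EventuallyEq.refl _ _) fun _ => c] with ω hω
    rcases le_total c (M.efficient P X ω) with h | h
    · rw [loss_eq_zero _ h]; exact zero_le
    · rw [gain_eq_zero _ h, gain_eq_zero _ le_rfl, loss_eq_zero _ le_rfl, zero_add, zero_add,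
        add_zero] at hω
      exact le_add_self.trans hω
  refine ne_top_of_le_ne_top ?_ (lintegral_mono_ae hle)
  rw [lintegral_statePrice_mul hP measurable_const]
  simp only [lintegral_const, measure_univ]
  finiteness

/-- The tangent at the efficient payoff bounds the gain of `Y` by an integrable gain plus $\xi Y$,
whose expectation is the finite price. -/
theorem lintegral_gain_ne_top (hP : P ∈ M.models) (hreg : M.RegularLikelihood P)
    (hX : Measurable X) (hfin : ∫⁻ ω, gain (M.marginal P X) c (X ω) ∂P ≠ ⊤)
    (hY : Y ∈ M.payoffs) : ∫⁻ ω, gain (M.marginal P X) c (Y ω) ∂P ≠ ⊤ := by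
  rw [lintegral_comp_eq_of_law_eq hX (measurable_efficient P X) (law_efficient hP hreg hX).symm
    (measurable_gain _ c)] at hfin
  have hY' := mem_payoffs_iff.1 hY
  have hle : ∀ᵐ ω ∂P, gain (M.marginal P X) c (Y ω)
      ≤ gain (M.marginal P X) c (M.efficient P X ω) + (M.statePrice P ω : ℝ≥0∞) * Y ω := by
    filter_upwards [tangent_le_ae c hP hreg hX (Filter.EventuallyEq.refl _ _) Y] with ω hω
    rcases le_total c (Y ω) with h | h
    · rw [loss_eq_zero _ h, add_zero] at hω
      exact le_self_add.trans hω
    · rw [gain_eq_zero _ h]; exact zero_le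
  refine ne_top_of_le_ne_top ?_ (lintegral_mono_ae hle)
  rw [lintegral_add_left (f := fun ω => gain (M.marginal P X) c (M.efficient P X ω))
      ((measurable_gain _ c).comp (measurable_efficient P X)),
    lintegral_statePrice_mul hP hY'.1]
  exact ENNReal.add_ne_top.2 ⟨hfin, ENNReal.mul_ne_top ENNReal.ofReal_ne_top hY'.2⟩

theorem lintegral_tangent (P : Measure Ω) (k : ℝ → ℝ≥0∞) (hY : Measurable Y) (hZ : Measurable Z) :
    ∫⁻ ω, (gain k c (Y ω) + (M.statePrice P ω * Z ω + loss k c (Z ω))) ∂P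
      = ∫⁻ ω, gain k c (Y ω) ∂P + (∫⁻ ω, M.statePrice P ω * Z ω ∂P + ∫⁻ ω, loss k c (Z ω) ∂P) := by
  have hm := measurable_statePrice (M := M) P
  rw [lintegral_add_left (f := fun ω => gain k c (Y ω)) ((measurable_gain k c).comp hY),
    lintegral_add_left (by fun_prop)]

/-- The efficient payoff maximizes expected utility among all payoffs that are not more
expensive. -/
theorem efficient_optimal (hP : P ∈ M.models) (hreg : M.RegularLikelihood P)
    (hX : Measurable X) (hZp : Z ∈ M.payoffs) (hZ : Z =ᵐ[P] M.efficient P X)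
    (hY : Measurable Y) (hle : ∫⁻ ω, Y ω ∂M.Q ≤ ∫⁻ ω, Z ω ∂M.Q) :
    ∫⁻ ω, gain (M.marginal P X) c (Y ω) ∂P + ∫⁻ ω, loss (M.marginal P X) c (Z ω) ∂P
      ≤ ∫⁻ ω, gain (M.marginal P X) c (Z ω) ∂P + ∫⁻ ω, loss (M.marginal P X) c (Y ω) ∂P := by
  obtain ⟨hZm, hZf⟩ := mem_payoffs_iff.1 hZp
  have h := lintegral_mono_ae (tangent_le_ae c hP hreg hX hZ Y)
  rw [lintegral_tangent c P _ hY hZm, lintegral_tangent c P _ hZm hY,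
    lintegral_statePrice_mul hP hY, lintegral_statePrice_mul hP hZm] at h
  set d := ENNReal.ofReal (Real.exp (-(M.r * M.T)))
  have hfin : d * ∫⁻ ω, Z ω ∂M.Q ≠ ⊤ := ENNReal.mul_ne_top ENNReal.ofReal_ne_top hZf
  rw [← ENNReal.add_le_add_iff_left hfin]
  calc _ = _ := add_left_comm _ _ _
    _ ≤ _ := h
    _ ≤ _ := by
      rw [add_left_comm]
      gcongr

/-- The efficient payoff is the only maximizer. -/
theorem efficient_unique (hP : P ∈ M.models) (hreg : M.RegularLikelihood P)
    (hX : Measurable X) (hZp : Z ∈ M.payoffs) (hZ : Z =ᵐ[P] M.efficient P X)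
    (hY : Measurable Y) (hle : ∫⁻ ω, Y ω ∂M.Q ≤ ∫⁻ ω, Z ω ∂M.Q)
    (hYg : ∫⁻ ω, gain (M.marginal P X) c (Y ω) ∂P ≠ ⊤)
    (hYl : ∫⁻ ω, loss (M.marginal P X) c (Y ω) ∂P ≠ ⊤)
    (hZg : ∫⁻ ω, gain (M.marginal P X) c (Z ω) ∂P ≠ ⊤)
    (hZl : ∫⁻ ω, loss (M.marginal P X) c (Z ω) ∂P ≠ ⊤)
    (hopt : ∫⁻ ω, gain (M.marginal P X) c (Z ω) ∂P + ∫⁻ ω, loss (M.marginal P X) c (Y ω) ∂P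
      ≤ ∫⁻ ω, gain (M.marginal P X) c (Y ω) ∂P + ∫⁻ ω, loss (M.marginal P X) c (Z ω) ∂P) :
    Y =ᵐ[P] Z := by
  obtain ⟨hZm, hZf⟩ := mem_payoffs_iff.1 hZp
  have hm := measurable_statePrice (M := M) P
  have hG := measurable_gain (M.marginal P X) c
  have hL := measurable_loss (M.marginal P X) c
  have hfin : ∫⁻ ω, (M.statePrice P ω : ℝ≥0∞) * Z ω ∂P ≠ ⊤ := by
    rw [lintegral_statePrice_mul hP hZm]
    exact ENNReal.mul_ne_top ENNReal.ofReal_ne_top hZf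
  have heq := ae_eq_of_ae_le_of_lintegral_le (tangent_le_ae c hP hreg hX hZ Y)
    (by rw [lintegral_tangent c P _ hY hZm]; finiteness)
    ((hG.comp hZm).add ((by fun_prop : Measurable fun ω =>
      (M.statePrice P ω : ℝ≥0∞) * Y ω).add (hL.comp hY))).aemeasurable
    (by
      rw [lintegral_tangent c P _ hY hZm, lintegral_tangent c P _ hZm hY]
      calc _ = ∫⁻ ω, (M.statePrice P ω : ℝ≥0∞) * Y ω ∂P
            + (∫⁻ ω, gain (M.marginal P X) c (Z ω) ∂P
              + ∫⁻ ω, loss (M.marginal P X) c (Y ω) ∂P) := add_left_comm _ _ _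
        _ ≤ ∫⁻ ω, (M.statePrice P ω : ℝ≥0∞) * Z ω ∂P
            + (∫⁻ ω, gain (M.marginal P X) c (Y ω) ∂P
              + ∫⁻ ω, loss (M.marginal P X) c (Z ω) ∂P) := by
          refine add_le_add ?_ hopt
          rw [lintegral_statePrice_mul hP hY, lintegral_statePrice_mul hP hZm]
          gcongr
        _ = _ := add_left_comm _ _ _)
  -- An atomless state price a.s. misses the countably many slopes at rational points, one of which
  -- it would hit wherever `Y` and `Z` differ.
  have hneq : ∀ᵐ ω ∂P, ∀ q : ℚ, M.marginal P X q ≠ M.statePrice P ω := by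
    refine ae_all_iff.2 fun q => ?_
    filter_upwards [measure_eq_zero_iff_ae_notMem.1
      (measure_statePrice_eq hP hreg (M.marginal P X q).toNNReal)] with ω hω h
    refine hω ?_
    rw [h, ENNReal.toNNReal_coe]
  filter_upwards [heq, hneq, statePrice_supergradient hP hreg hX hZ,
    ae_lt_top (hG.comp hY) hYg, ae_lt_top (hL.comp hY) hYl, ae_lt_top (hG.comp hZm) hZg,
    ae_lt_top (hL.comp hZm) hZl] with ω h1 h2 h3 h4 h5 h6 h7
  by_contra hne
  obtain ⟨q, hq⟩ := exists_rat_eq_of_tangent_eq (antitone_marginal P X) c h3.1 h3.2 hne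
    h6.ne h7.ne h4.ne h5.ne h1
  exact h2 q hq

/-- Random variables with the same degenerate distribution coincide. -/
theorem exists_distFun_mem_Ioo (hP : P ∈ M.models) (hX : Measurable X) (hY : Measurable Y)
    (hlaw : law P X = law P Y) (hne : ¬ X =ᵐ[P] Y) :
    ∃ t : ℝ, 0 < distFun (law P X) t ∧ distFun (law P X) t < 1 := by
  have := M.isProb P hP
  by_contra! hcon
  have hchar : ∀ W : Ω → ℝ≥0, Measurable W → law P W = law P X →
      ∀ᵐ ω ∂P, ∀ q : ℚ, ((W ω : ℝ) ≤ q ↔ distFun (law P X) q = 1) := by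
    intro W hW hl
    refine ae_all_iff.2 fun q => ?_
    by_cases h0 : 0 < distFun (law P X) q
    · have h1 : distFun (law P X) q = 1 := le_antisymm (distFun_le_one _ _) (hcon q h0)
      have h2 : P.real {ω | (q : ℝ) < W ω} = 0 := by
        rw [measureReal_lt_eq_one_sub_distFun P hW, hl, h1, sub_self]
      rw [measureReal_eq_zero_iff, measure_eq_zero_iff_ae_notMem] at h2
      filter_upwards [h2] with ω hω
      exact iff_of_true (not_lt.1 hω) h1
    · have h1 : distFun (law P X) q = 0 := le_antisymm (not_lt.1 h0) (distFun_nonneg _ _)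
      have h2 : P.real {ω | (W ω : ℝ) ≤ q} = 0 := by
        rw [← distFun_law P hW, hl, h1]
      rw [measureReal_eq_zero_iff, measure_eq_zero_iff_ae_notMem] at h2
      filter_upwards [h2] with ω hω
      exact iff_of_false hω (by rw [h1]; norm_num)
  refine hne ?_
  filter_upwards [hchar X hX rfl, hchar Y hY hlaw.symm] with ω h1 h2
  rw [← NNReal.coe_inj]
  refine eq_of_forall_rat_lt_iff_lt fun q => ?_
  rw [← not_le, ← not_le, h1, h2]

/-- A payoff that is not efficient can be improved by a payoff that is not more expensive, is
nondecreasing in the likelihood ratio, and bounded. -/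
theorem exists_improvement (hP : P ∈ M.models) (hreg : M.RegularLikelihood P)
    (hX : X ∈ M.payoffs)
    (hfin : ∫⁻ ω, gain (M.marginal P X) c (X ω) ∂P ≠ ⊤) (hne : ¬ X =ᵐ[P] M.efficient P X) :
    ∃ Z ∈ M.payoffs, M.NondecreasingInLik P Z ∧ ∫⁻ ω, Z ω ∂M.Q ≤ ∫⁻ ω, X ω ∂M.Q ∧
      (∃ b : ℝ≥0, ∀ ω, Z ω ≤ b) ∧ ∫⁻ ω, loss (M.marginal P X) c (Z ω) ∂P ≠ ⊤ ∧
      ∫⁻ ω, gain (M.marginal P X) c (X ω) ∂P + ∫⁻ ω, loss (M.marginal P X) c (Z ω) ∂P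
        < ∫⁻ ω, gain (M.marginal P X) c (Z ω) ∂P
          + ∫⁻ ω, loss (M.marginal P X) c (X ω) ∂P := by
  have := M.isProb P hP
  have := M.isProb_Q
  obtain ⟨hXm, hXf⟩ := mem_payoffs_iff.1 hX
  set k := M.marginal P X with hk
  set E := M.efficient P X with hE
  have hka : Antitone k := antitone_marginal P X
  have hEm : Measurable E := measurable_efficient P X
  have hlaw : law P E = law P X := law_efficient hP hreg hXm
  have hlt : ∫⁻ ω, E ω ∂M.Q < ∫⁻ ω, X ω ∂M.Q := by
    by_contra h
    exact hne (ae_eq_efficient hP hreg hX (not_lt.1 h))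
  -- The efficient payoff stays below `t` with positive probability, and the slope is still positive
  -- at some `y > t`.
  obtain ⟨t, ht0, ht1⟩ := exists_distFun_mem_Ioo hP hXm hEm hlaw.symm hne
  obtain ⟨y, hty, hy1⟩ := exists_gt_distFun_lt _ ht1
  obtain ⟨δ, hδ0, hδ⟩ := ENNReal.lt_iff_exists_nnreal_btwn.1 (tsub_pos_of_lt hlt)
  -- The bonus `ε` is covered by the saved cost, and is small enough that raising a value below `t`
  -- by `ε` stays in the region where the slope is at least `k y`.
  obtain ⟨ε, hε0, hεδ, hεy⟩ : ∃ ε : ℝ≥0, 0 < ε ∧ ε ≤ δ ∧ (ε : ℝ) ≤ y - t := by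
    refine ⟨min δ (y - t).toNNReal, lt_min (by exact_mod_cast hδ0) (by simpa using hty),
      min_le_left _ _, ?_⟩
    calc ((min δ (y - t).toNNReal : ℝ≥0) : ℝ) ≤ (y - t).toNNReal := by
          exact_mod_cast min_le_right _ _
      _ = y - t := Real.coe_toNNReal _ (by linarith)
  have hEg : ∫⁻ ω, gain k c (E ω) ∂P = ∫⁻ ω, gain k c (X ω) ∂P :=
    lintegral_comp_eq_of_law_eq hEm hXm hlaw (measurable_gain k c)
  have hEl : ∫⁻ ω, loss k c (E ω) ∂P = ∫⁻ ω, loss k c (X ω) ∂P :=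
    lintegral_comp_eq_of_law_eq hEm hXm hlaw (measurable_loss k c)
  have hXl : ∫⁻ ω, loss k c (X ω) ∂P ≠ ⊤ := lintegral_loss_ne_top c hP hreg hXm
  have hBle : ∫⁻ ω, loss k c (E ω + ε) ∂P ≠ ⊤ :=
    ne_top_of_le_ne_top (hEl ▸ hXl) (lintegral_mono fun ω => loss_anti k c le_self_add)
  set B : Set Ω := {ω | (E ω : ℝ) ≤ t} with hB
  have hBm : MeasurableSet B := measurableSet_le (by fun_prop) measurable_const
  have hpt : ∀ ω, gain k c (E ω) + loss k c (E ω + ε) + B.indicator (fun _ => k y * ε) ω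
      ≤ gain k c (E ω + ε) + loss k c (E ω) := by
    intro ω
    have hI := setLIntegral_Icc_shift k c (x := E ω) (z := (E ω + ε : ℝ≥0))
      (by exact_mod_cast le_self_add)
    refine le_trans ?_ hI.le
    refine add_le_add le_rfl ?_
    by_cases hω : ω ∈ B
    · rw [Set.indicator_of_mem hω]
      have hω' : (E ω : ℝ) ≤ t := hω
      refine le_trans (le_of_eq ?_) (mul_le_setLIntegral_Icc (s := k y) fun z hz => hka ?_)
      · simp
      · push_cast at hz
        linarith
    · rw [Set.indicator_of_notMem hω]; exact zero_le
  have hmain : ∫⁻ ω, gain k c (X ω) ∂P + ∫⁻ ω, loss k c (E ω + ε) ∂P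
      < ∫⁻ ω, gain k c (E ω + ε) ∂P + ∫⁻ ω, loss k c (X ω) ∂P := by
    have hint := lintegral_mono (μ := P) hpt
    have hm1 : Measurable fun ω => gain k c (E ω) := (measurable_gain k c).comp hEm
    have hm2 : Measurable fun ω => loss k c (E ω + ε) :=
      (measurable_loss k c).comp (hEm.add_const ε)
    have hm3 : Measurable fun ω => gain k c (E ω + ε) :=
      (measurable_gain k c).comp (hEm.add_const ε)
    rw [lintegral_add_left (f := fun ω => gain k c (E ω) + loss k c (E ω + ε)) (hm1.add hm2),
      lintegral_add_left hm1, lintegral_add_left hm3,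
      lintegral_indicator_const hBm, hEg, hEl] at hint
    refine lt_of_lt_of_le (ENNReal.lt_add_right (ENNReal.add_ne_top.2 ⟨hfin, hBle⟩) ?_) hint
    refine mul_ne_zero (mul_ne_zero (marginal_ne_zero hP hy1) (by exact_mod_cast hε0.ne')) ?_
    intro h0
    rw [← hlaw, distFun_law P hEm, Measure.real, ← hB, h0] at ht0
    simp at ht0
  -- Truncation makes the improvement bounded; by monotone convergence the strict inequality
  -- survives at some finite level.
  have hsup : ∫⁻ ω, gain k c (E ω + ε) ∂P
      = ⨆ n : ℕ, ∫⁻ ω, gain k c (min (E ω) n + ε) ∂P := by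
    rw [← lintegral_iSup (f := fun (n : ℕ) ω => gain k c (min (E ω) n + ε))
      (fun n => (measurable_gain k c).comp ((hEm.min measurable_const).add_const ε))
      (fun m n hmn ω => gain_mono k c
        (add_le_add_left (min_le_min_left _ (by exact_mod_cast hmn)) _))]
    refine lintegral_congr fun ω => le_antisymm ?_ (iSup_le fun n =>
      gain_mono k c (add_le_add_left (min_le_left _ _) _))
    obtain ⟨n, hn⟩ := exists_nat_ge (E ω)
    refine le_iSup_of_le n ?_
    rw [min_eq_left hn]
  rw [hsup, ENNReal.iSup_add] at hmain
  obtain ⟨n, hn⟩ := lt_iSup_iff.1 hmain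
  -- Truncating above `c` leaves the losses unchanged.
  obtain ⟨m, hm⟩ := exists_nat_ge c
  set N := max n m with hN
  have hcN : c ≤ (N : ℝ≥0) := hm.trans (by exact_mod_cast le_max_right n m)
  have hlossZ : ∀ ω, loss k c (min (E ω) N + ε) = loss k c (E ω + ε) := by
    intro ω
    rcases le_total (E ω) N with h | h
    · rw [min_eq_left h]
    · rw [min_eq_right h, loss_eq_zero k (hcN.trans le_self_add),
        loss_eq_zero k ((hcN.trans h).trans le_self_add)]
  have hZm : Measurable fun ω => min (E ω) (N : ℝ≥0) + ε :=
    (hEm.min measurable_const).add_const ε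
  have hcost : ∫⁻ ω, ((min (E ω) (N : ℝ≥0) + ε : ℝ≥0) : ℝ≥0∞) ∂M.Q ≤ ∫⁻ ω, X ω ∂M.Q := by
    calc _ ≤ ∫⁻ ω, ((E ω : ℝ≥0∞) + ε) ∂M.Q := by
          refine lintegral_mono fun ω => ?_
          rw [← ENNReal.coe_add, ENNReal.coe_le_coe]
          exact add_le_add_left (min_le_left (E ω) (N : ℝ≥0)) ε
      _ = ∫⁻ ω, E ω ∂M.Q + ε := by
          rw [lintegral_add_right _ measurable_const, lintegral_const, measure_univ, mul_one]
      _ ≤ ∫⁻ ω, E ω ∂M.Q + (∫⁻ ω, X ω ∂M.Q - ∫⁻ ω, E ω ∂M.Q) := by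
          gcongr
          exact le_trans (by exact_mod_cast hεδ) hδ.le
      _ = _ := add_tsub_cancel_of_le hlt.le
  refine ⟨fun ω => min (E ω) N + ε, mem_payoffs_iff.2 ⟨hZm, ne_top_of_le_ne_top hXf hcost⟩,
    ?_, hcost, ⟨N + ε, fun ω => add_le_add_left (min_le_right _ _) _⟩, ?_, ?_⟩
  · obtain ⟨A, hA, hA'⟩ := efficient_nondecreasing hP hreg X
    exact ⟨A, hA, fun ω hω ω' hω' h =>
      add_le_add_left (min_le_min_right _ (hA' ω hω ω' hω' h)) _⟩
  · simp_rw [hlossZ]; exact hBle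
  · simp_rw [hlossZ]
    refine hn.trans_le ?_
    gcongr with ω
    exact gain_mono k c (add_le_add_left (min_le_min_left _ (by exact_mod_cast le_max_left n m)) _)

end Optimality

end Market

/-! ### Real-valued preferences from expected utility -/

/-- A strictly increasing map of the extended reals into the reals. -/
noncomputable def squash (x : EReal) : ℝ :=
  if x = ⊥ then -(Real.pi / 2) else if x = ⊤ then Real.pi / 2 else Real.arctan x.toReal

theorem squash_strictMono : StrictMono squash := by
  intro x y h
  induction x with
  | bot =>
    induction y with
    | bot => exact absurd h (lt_irrefl _)
    | top => simp [squash]; linarith [Real.pi_pos]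
    | coe y => simpa [squash] using Real.neg_pi_div_two_lt_arctan y
  | top => exact absurd h not_top_lt
  | coe x =>
    induction y with
    | bot => exact absurd h not_lt_bot
    | top => simpa [squash] using Real.arctan_lt_pi_div_two x
    | coe y => simpa [squash] using Real.arctan_strictMono (EReal.coe_lt_coe_iff.1 h)

theorem expectedUtility_eq_of_law_eq {Ω : Type*} [MeasurableSpace Ω] (M : Market Ω)
    (P₀ : Measure Ω) (X₀ : Ω → ℝ≥0) (c : ℝ≥0) {P : Measure Ω} {X Y : Ω → ℝ≥0}
    (hX : Measurable X) (hY : Measurable Y) (h : law P X = law P Y) :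
    expectedUtility (M.utility P₀ X₀ c) P X = expectedUtility (M.utility P₀ X₀ c) P Y := by
  rw [Market.expectedUtility_eq, Market.expectedUtility_eq,
    lintegral_comp_eq_of_law_eq hX hY h (measurable_gain _ c),
    lintegral_comp_eq_of_law_eq hX hY h (measurable_loss _ c)]

/-! ### Expected utility: worst cases, optimality and improvement -/

namespace Market

variable {Ω : Type*} [MeasurableSpace Ω] {M : Market Ω} {𝔽 : Set (ℝ≥0 → ℝ)} {P : Measure Ω}
  {X Y : Ω → ℝ≥0} {c : ℝ≥0}

theorem mem_budget_utility_iff {P' : Measure Ω} {x₀ : ℝ} :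
    Y ∈ M.budget (expectedUtility (M.utility P X c) P') x₀ ↔
      Y ∈ M.payoffs ∧ (∫⁻ ω, gain (M.marginal P X) c (Y ω) ∂P' ≠ ⊤ ∧
        ∫⁻ ω, loss (M.marginal P X) c (Y ω) ∂P' ≠ ⊤) ∧ M.price Y ≤ x₀ := by
  rw [← ereal_sub_ne, ← expectedUtility_eq]
  simp only [budget, Set.mem_ofPred_eq, and_assoc]

theorem gain_ne_top_of_expectedUtility_lt_top {P' : Measure Ω}
    (h : expectedUtility (M.utility P X c) P' Y < ⊤)
    (hl : ∫⁻ ω, loss (M.marginal P X) c (Y ω) ∂P' ≠ ⊤) :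
    ∫⁻ ω, gain (M.marginal P X) c (Y ω) ∂P' ≠ ⊤ := by
  intro ht
  rw [expectedUtility_eq, ht, ereal_top_sub hl] at h
  exact lt_irrefl _ h

/-- Expected utilities increase along the integral order. -/
theorem expectedUtility_le_of_integralOrder (hSSD : SSD ⊆ 𝔽) (hP : P ∈ M.models)
    (hreg : M.RegularLikelihood P) (hX : Measurable X) (hc : 0 < distFun (law P X) c)
    (hfin : ∫⁻ ω, gain (M.marginal P X) c (X ω) ∂P ≠ ⊤) (hY : Y ∈ M.payoffs)
    {P' : Measure Ω} (hP' : P' ∈ M.models) (h : IntegralOrder 𝔽 (law P Y) (law P' Y)) :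
    expectedUtility (M.utility P X c) P Y ≤ expectedUtility (M.utility P X c) P' Y := by
  have := M.isProb P hP
  have := M.isProb P' hP'
  have hYm := (mem_payoffs_iff.1 hY).1
  have hk : Antitone (M.marginal P X) := antitone_marginal P X
  rw [expectedUtility_eq, expectedUtility_eq]
  by_cases hl : ∫⁻ ω, loss (M.marginal P X) c (Y ω) ∂P = ⊤
  · rw [hl, ereal_sub_top]; exact bot_le
  have hl' := ne_top_of_le_ne_top hl (lintegral_loss_le hk c hSSD hYm h)
  by_cases hg' : ∫⁻ ω, gain (M.marginal P X) c (Y ω) ∂P' = ⊤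
  · rw [hg', ereal_top_sub hl']; exact le_top
  have hg := lintegral_gain_ne_top c hP hreg hX hfin hY
  rw [ereal_sub_le_sub_iff hg hl hg' hl']
  exact lintegral_gain_add_loss_le hk c (marginal_ne_top hc) hSSD hYm h hg hg'

theorem expectedUtility_le_efficient (hP : P ∈ M.models) (hreg : M.RegularLikelihood P)
    (hX : X ∈ M.payoffs) (hfin : ∫⁻ ω, gain (M.marginal P X) c (X ω) ∂P ≠ ⊤)
    (hXE : X =ᵐ[P] M.efficient P X) (hY : Y ∈ M.payoffs) (hle : M.price Y ≤ M.price X) :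
    expectedUtility (M.utility P X c) P Y ≤ expectedUtility (M.utility P X c) P X := by
  have hXm := (mem_payoffs_iff.1 hX).1
  have hYm := (mem_payoffs_iff.1 hY).1
  rw [expectedUtility_eq, expectedUtility_eq]
  by_cases hl : ∫⁻ ω, loss (M.marginal P X) c (Y ω) ∂P = ⊤
  · rw [hl, ereal_sub_top]; exact bot_le
  rw [ereal_sub_le_sub_iff (lintegral_gain_ne_top c hP hreg hXm hfin hY) hl hfin
    (lintegral_loss_ne_top c hP hreg hXm)]
  exact efficient_optimal c hP hreg hXm hX hXE hYm ((price_le_iff hY hX).1 hle)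

theorem ae_eq_of_efficient_le_expectedUtility (hP : P ∈ M.models) (hreg : M.RegularLikelihood P)
    (hX : X ∈ M.payoffs) (hfin : ∫⁻ ω, gain (M.marginal P X) c (X ω) ∂P ≠ ⊤)
    (hXE : X =ᵐ[P] M.efficient P X) (hY : Y ∈ M.payoffs) (hle : M.price Y ≤ M.price X)
    (hopt : expectedUtility (M.utility P X c) P X ≤ expectedUtility (M.utility P X c) P Y) :
    Y =ᵐ[P] X := by
  have hXm := (mem_payoffs_iff.1 hX).1
  have hYm := (mem_payoffs_iff.1 hY).1
  have hXl := lintegral_loss_ne_top c hP hreg hXm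
  have hYg := lintegral_gain_ne_top c hP hreg hXm hfin hY
  rw [expectedUtility_eq, expectedUtility_eq] at hopt
  have hYl : ∫⁻ ω, loss (M.marginal P X) c (Y ω) ∂P ≠ ⊤ := by
    intro ht
    rw [ht, ereal_sub_top, le_bot_iff] at hopt
    exact (ereal_sub_ne.2 ⟨hfin, hXl⟩).1 hopt
  rw [ereal_sub_le_sub_iff hfin hXl hYg hYl] at hopt
  exact efficient_unique c hP hreg hXm hX hXE hYm ((price_le_iff hY hX).1 hle) hYg hYl hfin hXl
    hopt

theorem worstCase_le {V : Measure Ω → (Ω → ℝ≥0) → EReal} (hP : P ∈ M.models) (Y : Ω → ℝ≥0) :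
    M.worstCase V Y ≤ V P Y :=
  iInf₂_le P hP

theorem mem_robustBudget_ofReal {W : Measure Ω → (Ω → ℝ≥0) → ℝ} {x₀ : ℝ}
    (hY : Y ∈ M.payoffs) (hle : M.price Y ≤ x₀) : Y ∈ M.robustBudget (ofReal W) x₀ :=
  fun _ _ => ⟨hY, EReal.coe_ne_bot _, EReal.coe_ne_top _, hle⟩

/-- Under first-order dominance, a payoff that is not efficient can be improved for the
least favorable measure by a payoff whose worst case is that measure. -/
theorem exists_robust_improvement (hP : M.LeastFavorable FSD P)
    (hreg : M.RegularLikelihood P) (hX : X ∈ M.payoffs) (hc : 0 < distFun (law P X) c)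
    (hfin : ∫⁻ ω, gain (M.marginal P X) c (X ω) ∂P ≠ ⊤) (hne : ¬ X =ᵐ[P] M.efficient P X) :
    ∃ Z ∈ M.robustBudget (expectedUtility (M.utility P X c)) (M.price X),
      expectedUtility (M.utility P X c) P X < expectedUtility (M.utility P X c) P Z ∧
      expectedUtility (M.utility P X c) P Z
        ≤ M.worstCase (expectedUtility (M.utility P X c)) Z := by
  have := M.isProb P hP.1
  obtain ⟨hXm, hXf⟩ := mem_payoffs_iff.1 hX
  have hk : Antitone (M.marginal P X) := antitone_marginal P X
  have hSSD : SSD ⊆ FSD := fun f hf => hf.1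
  obtain ⟨Z, hZ, hmono, hcost, ⟨b, hb⟩, hZl, hlt⟩ := exists_improvement c hP.1 hreg hX hfin hne
  have hZm := (mem_payoffs_iff.1 hZ).1
  have hord : ∀ P' ∈ M.models, IntegralOrder FSD (law P Z) (law P' Z) := by
    intro P' hP'
    have := M.isProb P' hP'
    exact integralOrder_FSD_of_nondecreasing ((M.equiv P' hP').1.trans (M.equiv P hP.1).2)
      (measurable_lik P) hZm hmono (hP.2 P' hP')
  -- Here the boundedness of `Z` matters: it keeps expected gains finite under every model, as
  -- membership in the robust budget requires.
  have hgain : ∀ P' ∈ M.models, ∫⁻ ω, gain (M.marginal P X) c (Z ω) ∂P' ≠ ⊤ := by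
    intro P' hP'
    have := M.isProb P' hP'
    refine ne_top_of_le_ne_top ?_ (lintegral_mono fun ω => gain_mono _ c (hb ω))
    rw [lintegral_const, measure_univ, mul_one]
    exact gain_ne_top hk (marginal_ne_top hc) b
  refine ⟨Z, fun P' hP' => mem_budget_utility_iff.2 ⟨hZ, ⟨hgain P' hP', ?_⟩,
    (price_le_iff hZ hX).2 hcost⟩, ?_, le_iInf₂ fun P' hP' => ?_⟩
  · have := M.isProb P' hP'
    exact ne_top_of_le_ne_top hZl (lintegral_loss_le hk c hSSD hZm (hord P' hP'))
  · rw [← not_le, expectedUtility_eq, expectedUtility_eq, ereal_sub_le_sub_iff (hgain P hP.1) hZl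
      hfin (lintegral_loss_ne_top c hP.1 hreg hXm), not_le]
    exact hlt
  · exact expectedUtility_le_of_integralOrder hSSD hP.1 hreg hXm hc hfin hZ hP' (hord P' hP')

/-- A nondecreasing function of the likelihood ratio is cost-efficient, so under (b) efficiency
needs no optimality hypothesis. -/
theorem ae_eq_efficient_of_compatible (hFSD : 𝔽 ⊆ FSD) (hP : P ∈ M.models)
    (hreg : M.RegularLikelihood P) (hX : X ∈ M.payoffs) (h : M.Compatible 𝔽 P X) :
    X =ᵐ[P] M.efficient P X := by
  obtain ⟨⟨f, hf, hXf⟩, -⟩ := h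
  refine ae_eq_efficient_of_costEfficient hP hreg (costEfficient_of_nondecreasing hP hreg hX
    ⟨{ω | (X ω : ℝ) = f (M.lik P ω)}, hXf, fun ω hω ω' hω' hle => ?_⟩)
  rw [← NNReal.coe_le_coe, show (X ω : ℝ) = _ from hω, show (X ω' : ℝ) = _ from hω']
  exact hFSD hf hle

end Market

end RobustCE

/-! ### The equivalence -/

open RobustCE Market in
theorem theorem5 {Ω : Type*} [MeasurableSpace Ω] (M : RobustCE.Market Ω)
    (𝔽 : Set (ℝ≥0 → ℝ)) (hSSD : RobustCE.SSD ⊆ 𝔽) (hFSD : 𝔽 ⊆ RobustCE.FSD)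
    (hcomp : RobustCE.CompositionConsistent 𝔽) (hcost : M.CostConsistent 𝔽)
    (Pst : Measure Ω) (hPst : M.LeastFavorable 𝔽 Pst) (hreg : M.RegularLikelihood Pst)
    (Xst : Ω → ℝ≥0) (hX : Xst ∈ M.payoffs)
    (x₀ : ℝ) (hx₀ : x₀ = M.price Xst)
    (c : ℝ≥0) (hc : 0 < c) (hFc : 0 < RobustCE.distFun (RobustCE.law Pst Xst) c)
    (u : ℝ≥0 → EReal) (hu : u = M.utility Pst Xst c)
    (hfin : ∀ P ∈ M.models, RobustCE.expectedUtility u P Xst < ⊤)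
    (hab : 𝔽 = RobustCE.FSD ∨ M.Compatible 𝔽 Pst Xst) :
    List.TFAE [
      M.CostEfficient Pst Xst,
      ∀ᵐ ω ∂Pst, (Xst ω : ℝ≥0∞) = RobustCE.quantile (RobustCE.law Pst Xst)
        (RobustCE.distFun (RobustCE.law Pst (M.lik Pst)) (M.lik Pst ω)),
      M.NondecreasingInLik Pst Xst,
      M.RobustCostEfficient 𝔽 (RobustCE.law Pst Xst) Xst,
      RobustCE.IsSolution (M.budget (RobustCE.expectedUtility u Pst) x₀)
        (RobustCE.expectedUtility u Pst) Xst,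
      RobustCE.IsSolution (M.robustBudget (RobustCE.expectedUtility u) x₀)
          (M.worstCase (RobustCE.expectedUtility u)) Xst ∧
        (𝔽 = RobustCE.FSD →
          RobustCE.OnlySolution Pst (M.robustBudget (RobustCE.expectedUtility u) x₀)
            (M.worstCase (RobustCE.expectedUtility u)) Xst),
      ∃ W : Measure Ω → (Ω → ℝ≥0) → ℝ,
        M.FamilyConsistent 𝔽 (M.robustBudget (RobustCE.ofReal W) x₀) Pst (RobustCE.ofReal W) ∧
        Xst ∈ M.robustBudget (RobustCE.ofReal W) x₀ ∧
        RobustCE.IsSolution (M.budget (RobustCE.ofReal W Pst) x₀) (RobustCE.ofReal W Pst) Xst ∧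
        (𝔽 = RobustCE.FSD →
          RobustCE.OnlySolution Pst (M.budget (RobustCE.ofReal W Pst) x₀)
            (RobustCE.ofReal W Pst) Xst ∧
          M.LawInvariant (RobustCE.ofReal W)),
      ∃ W : Measure Ω → (Ω → ℝ≥0) → ℝ,
        M.FamilyConsistent 𝔽 (M.robustBudget (RobustCE.ofReal W) x₀) Pst (RobustCE.ofReal W) ∧
        RobustCE.IsSolution (M.robustBudget (RobustCE.ofReal W) x₀)
          (M.worstCase (RobustCE.ofReal W)) Xst ∧
        (𝔽 = RobustCE.FSD →
          RobustCE.OnlySolution Pst (M.robustBudget (RobustCE.ofReal W) x₀)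
            (M.worstCase (RobustCE.ofReal W)) Xst ∧
          M.LawInvariant (RobustCE.ofReal W))] := by
  have hPm := hPst.1
  have hXm : Measurable Xst := (mem_payoffs_iff.1 hX).1
  subst hx₀ hu
  set V : Measure Ω → (Ω → ℝ≥0) → EReal := expectedUtility (M.utility Pst Xst c) with hV
  have hloss := lintegral_loss_ne_top c hPm hreg hXm
  have hgain := gain_ne_top_of_expectedUtility_lt_top (hfin Pst hPm) hloss
  have hE := efficient_mem_payoffs hPm hreg hX
  have hEle : M.price (M.efficient Pst Xst) ≤ M.price Xst :=
    (price_le_iff hE hX).2 (lintegral_efficient_le hPm hreg hXm)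
  have hEord : ∀ P ∈ M.models,
      IntegralOrder 𝔽 (law Pst (M.efficient Pst Xst)) (law P (M.efficient Pst Xst)) :=
    fun P hP => Market.integralOrder_efficient hFSD hcomp hPst hreg hab hP
  have hVord : ∀ Y ∈ M.payoffs, ∀ P ∈ M.models, IntegralOrder 𝔽 (law Pst Y) (law P Y) →
      V Pst Y ≤ V P Y := fun Y hY P hP h =>
    expectedUtility_le_of_integralOrder hSSD hPm hreg hXm hFc hgain hY hP h
  have hVlaw : ∀ P, ∀ X ∈ M.payoffs, ∀ Y ∈ M.payoffs, law P X = law P Y → V P X = V P Y :=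
    fun P X hX Y hY h => expectedUtility_eq_of_law_eq M Pst Xst c (mem_payoffs_iff.1 hX).1
      (mem_payoffs_iff.1 hY).1 h
  have hVle : Xst =ᵐ[Pst] M.efficient Pst Xst → ∀ Y ∈ M.payoffs, M.price Y ≤ M.price Xst →
      V Pst Y ≤ V Pst Xst := fun h Y hY hle =>
    expectedUtility_le_efficient hPm hreg hX hgain h hY hle
  have hVuniq : Xst =ᵐ[Pst] M.efficient Pst Xst → ∀ Y ∈ M.payoffs, M.price Y ≤ M.price Xst →
      V Pst Xst ≤ V Pst Y → Y =ᵐ[Pst] Xst := fun h Y hY hle hopt =>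
    ae_eq_of_efficient_le_expectedUtility hPm hreg hX hgain h hY hle hopt
  have hXord : Xst =ᵐ[Pst] M.efficient Pst Xst → ∀ P ∈ M.models,
      IntegralOrder 𝔽 (law Pst Xst) (law P Xst) := fun h P hP =>
    integralOrder_congr_efficient hFSD hcomp hPst hreg hab h hP
  have hbudget : Xst ∈ M.budget (V Pst) (M.price Xst) :=
    mem_budget_utility_iff.2 ⟨hX, ⟨hgain, hloss⟩, le_rfl⟩
  -- Preferences must be real-valued, which expected utilities need not be. Squashing preserves the
  -- order, and every affordable payoff enters the budget.
  set W : Measure Ω → (Ω → ℝ≥0) → ℝ := fun P Y => squash (V P Y) with hW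
  have hWle : ∀ {P P' : Measure Ω} {Y Y' : Ω → ℝ≥0},
      ofReal W P Y ≤ ofReal W P' Y' ↔ V P Y ≤ V P' Y' := by
    intro P P' Y Y'
    exact EReal.coe_le_coe_iff.trans squash_strictMono.le_iff_le
  have hWcons : M.FamilyConsistent 𝔽 (M.robustBudget (ofReal W) (M.price Xst)) Pst (ofReal W) :=
    fun Y hY h P hP => hWle.2 (hVord Y (hY Pst hPm).1 P hP (h P hP))
  have hWlaw : M.LawInvariant (ofReal W) := fun P _ X hX Y hY h => by
    simp only [ofReal, hW, hVlaw P X hX Y hY h]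
  have hXW : Xst ∈ M.robustBudget (ofReal W) (M.price Xst) :=
    mem_robustBudget_ofReal hX le_rfl
  have hEW : ∀ W' : Measure Ω → (Ω → ℝ≥0) → ℝ,
      M.efficient Pst Xst ∈ M.robustBudget (ofReal W') (M.price Xst) :=
    fun W' => mem_robustBudget_ofReal hE hEle
  tfae_have 2 ↔ 1 := by
    rw [quantile_iff_ae_eq_efficient hPm hreg]
    exact ⟨fun h => costEfficient_of_nondecreasing hPm hreg hX
      (nondecreasing_of_ae_eq_efficient hPm hreg h), ae_eq_efficient_of_costEfficient hPm hreg⟩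
  tfae_have 3 → 1 := costEfficient_of_nondecreasing hPm hreg hX
  tfae_have 1 → 3 := fun h => nondecreasing_of_ae_eq_efficient hPm hreg
    (ae_eq_efficient_of_costEfficient hPm hreg h)
  tfae_have 4 ↔ 1 := robustCostEfficient_iff hFSD hcomp hcost hPst hreg hX hab
  tfae_have 2 → 5 := by
    rw [quantile_iff_ae_eq_efficient hPm hreg]
    exact fun h => ⟨hbudget, fun Y hY => hVle h Y hY.1 hY.2.2.2⟩
  tfae_have 2 → 6 := by
    rw [quantile_iff_ae_eq_efficient hPm hreg]
    intro h
    have hworst : V Pst Xst ≤ M.worstCase V Xst :=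
      le_iInf₂ fun P hP => hVord Xst hX P hP (hXord h P hP)
    have hXb : Xst ∈ M.robustBudget V (M.price Xst) := by
      intro P hP
      have := M.isProb P hP
      have := M.isProb Pst hPm
      -- Losses under the other models are dominated by those under the least favorable one; gains
      -- are finite by assumption.
      have hl := ne_top_of_le_ne_top hloss
        (lintegral_loss_le (antitone_marginal Pst Xst) c hSSD hXm (hXord h P hP))
      exact mem_budget_utility_iff.2
        ⟨hX, ⟨gain_ne_top_of_expectedUtility_lt_top (hfin P hP) hl, hl⟩, le_rfl⟩
    refine ⟨⟨hXb, fun Y hY => ?_⟩, fun _ Y hY => ?_⟩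
    · have hYb := hY Pst hPm
      exact ((worstCase_le hPm Y).trans (hVle h Y hYb.1 hYb.2.2.2)).trans hworst
    · have hYb := hY.1 Pst hPm
      exact hVuniq h Y hYb.1 hYb.2.2.2 ((hworst.trans (hY.2 Xst hXb)).trans (worstCase_le hPm Y))
  tfae_have 2 → 7 := by
    rw [quantile_iff_ae_eq_efficient hPm hreg]
    intro h
    refine ⟨W, hWcons, hXW, ⟨hXW Pst hPm, fun Y hY => hWle.2 (hVle h Y hY.1 hY.2.2.2)⟩,
      fun _ => ⟨fun Y hY => ?_, hWlaw⟩⟩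
    exact hVuniq h Y hY.1.1 hY.1.2.2.2 (hWle.1 (hY.2 Xst (hXW Pst hPm)))
  tfae_have 2 → 8 := by
    rw [quantile_iff_ae_eq_efficient hPm hreg]
    intro h
    have hworst : ofReal W Pst Xst ≤ M.worstCase (ofReal W) Xst :=
      le_iInf₂ fun P hP => hWcons Xst hXW (hXord h) P hP
    refine ⟨W, hWcons, ⟨hXW, fun Y hY => ?_⟩, fun _ => ⟨fun Y hY => ?_, hWlaw⟩⟩
    · have hYb := hY Pst hPm
      exact ((worstCase_le hPm Y).trans (hWle.2 (hVle h Y hYb.1 hYb.2.2.2))).trans hworst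
    · have hYb := hY.1 Pst hPm
      exact hVuniq h Y hYb.1 hYb.2.2.2 (hWle.1 ((hworst.trans (hY.2 Xst hXW)).trans
        (worstCase_le hPm Y)))
  have hback : M.Compatible 𝔽 Pst Xst → Xst =ᵐ[Pst] M.efficient Pst Xst :=
    ae_eq_efficient_of_compatible hFSD hPm hreg hX
  tfae_have 5 → 2 := by
    rw [quantile_iff_ae_eq_efficient hPm hreg]
    intro h
    rcases hab with rfl | hab
    · by_contra hne
      obtain ⟨Z, hZ, hlt, -⟩ := exists_robust_improvement hPst hreg hX hFc hgain hne
      exact (h.2 Z (hZ Pst hPm)).not_gt hlt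
    · exact hback hab
  tfae_have 6 → 2 := by
    rw [quantile_iff_ae_eq_efficient hPm hreg]
    intro h
    rcases hab with rfl | hab
    · by_contra hne
      obtain ⟨Z, hZ, hlt, hle⟩ := exists_robust_improvement hPst hreg hX hFc hgain hne
      exact ((hle.trans (h.1.2 Z hZ)).trans (worstCase_le hPm Xst)).not_gt hlt
    · exact hback hab
  tfae_have 7 → 2 := by
    rw [quantile_iff_ae_eq_efficient hPm hreg]
    rintro ⟨W', -, -, hsol, huniq⟩
    rcases hab with rfl | hab
    · obtain ⟨hu, hl⟩ := huniq rfl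
      -- Law invariance gives the affordable efficient payoff the same value as `Xst`, so it is also
      -- a maximizer and uniqueness applies.
      have heq := hl Pst hPm _ hE _ hX (law_efficient hPm hreg hXm)
      exact (hu _ ⟨hEW W' Pst hPm, fun Y hY => heq ▸ hsol.2 Y hY⟩).symm
    · exact hback hab
  tfae_have 8 → 2 := by
    rw [quantile_iff_ae_eq_efficient hPm hreg]
    rintro ⟨W', hcons, hsol, huniq⟩
    rcases hab with rfl | hab
    · obtain ⟨hu, hl⟩ := huniq rfl
      have heq := hl Pst hPm _ hE _ hX (law_efficient hPm hreg hXm)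
      -- Family consistency, applied to the efficient payoff, makes the least favorable measure its
      -- worst case.
      have hle : ofReal W' Pst Xst ≤ M.worstCase (ofReal W') (M.efficient Pst Xst) :=
        le_iInf₂ fun P hP => heq ▸ hcons _ (hEW W') hEord P hP
      exact (hu _ ⟨hEW W', fun Y hY =>
        ((hsol.2 Y hY).trans (worstCase_le hPm Xst)).trans hle⟩).symm
    · exact hback hab
  tfae_finish
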